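/- Fix $\rho>0$. For each $n\ge 1$, let $Z^0_1,Z^0_2,\dots$ and $Z^1_1,Z^1_2,\dots$ be mutually independent random variables, uniformly distributed on a set of $n$ bins, and allocate $\lfloor\rho n\rfloor$ balls sequentially. The $t$-th ball is offered the primary bin $Z^0_t$. A two-thinning strategy is a function which, given the history (for each earlier ball, its primary bin, whether that was rejected, and the secondary bin used if so) and the currently offered primary bin, decides whether to accept or to reject the offer. If it accepts, the ball goes into $Z^0_t$; if it rejects, the ball goes into the first not yet used entry of the sequence $Z^1_1,Z^1_2,\dots$. Let $\mathrm{MaxLoad}^f_{\rho n}$ be the largest number of balls in a bin after $\lfloor\rho n\rfloor$ balls have been allocated by the strategy $f$. The $\ell$-threshold strategy, for real $\ell$, rejects a ball if and only if at least $\ell$ of the earlier balls had the same primary bin. "With high probability" means with probability tending to $1$ as $n\to\infty$. **Theorem.** Let $f=f_n$ be the $\sqrt{\frac{2\log n}{\log\log n}}$-threshold strategy for the allocation of $\lfloor\rho n\rfloor$ balls into $n$ bins. Then: 1. $f$ is asymptotically optimal: for every choice of strategies $g=g_n$ (one for each $n$, run on the same variables as $f_n$) and every $\varepsilon>0$, with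 high probability $\mathrm{MaxLoad}^f_{\rho n}\le(1+\varepsilon)\,\mathrm{MaxLoad}^g_{\rho n}$. 2. With high probability $\mathrm{MaxLoad}^f_{\rho n}=(1+o(1))\sqrt{\frac{8\log n}{\log\log n}}$; that is, for every $\varepsilon>0$, with high probability $$(1-\varepsilon)\sqrt{\frac{8\log n}{\log\log n}}\le\mathrm{MaxLoad}^f_{\rho n}\le(1+\varepsilon)\sqrt{\frac{8\log n}{\log\log n}}.$$ -/

import Mathlib

open MeasureTheory ProbabilityTheory Filter Topology

namespace TwoThinning

/-- What is revealed while one ball is allocated: its primary bin and, if that was rejected, the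
secondary bin (`none` means that the primary bin was accepted). -/
abbrev Record (n : ℕ) : Type := Fin n × Option (Fin n)

/-- The bin in which the ball ends up. -/
def Record.bin {n : ℕ} (r : Record n) : Fin n := r.2.getD r.1

/-- A two-thinning strategy for `n` bins: from the history of the process so far (the latest ball
first) and the primary bin suggested for the current ball it decides whether to reject
(`true`) or to accept (`false`) the suggestion. -/
abbrev Strategy (n : ℕ) : Type := List (Record n) → Fin n → Bool

/-- The number of rejections in a history. -/
def rejections {n : ℕ} (h : List (Record n)) : ℕ := h.countP fun r => r.2.isSome

/-- The number of primary allocations to the bin `m` in a history. -/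
def primaryCount {n : ℕ} (h : List (Record n)) (m : Fin n) : ℕ :=
  h.countP fun r => decide (r.1 = m)

/-- The number of balls in the bin `m` after a history. -/
def load {n : ℕ} (h : List (Record n)) (m : Fin n) : ℕ :=
  h.countP fun r => decide (r.bin = m)

/-- The history after `t` balls under the strategy `f`. The primary bin of the ball number `t`
(counted from `0`) is `z₀ t`; each rejection uses up the next entry of the pool `z₁` of
secondary allocations. -/
def history {n : ℕ} (f : Strategy n) (z₀ z₁ : ℕ → Fin n) : ℕ → List (Record n)
  | 0 => []
  | t + 1 =>
    let h := history f z₀ z₁ t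
    (z₀ t, if f h (z₀ t) then some (z₁ (rejections h)) else none) :: h

/-- The load of the most heavily loaded bin after `t` balls under the strategy `f`. -/
def maxLoad {n : ℕ} (f : Strategy n) (z₀ z₁ : ℕ → Fin n) (t : ℕ) : ℕ :=
  Finset.univ.sup fun m : Fin n => load (history f z₀ z₁ t) m

/-- The `ℓ`-threshold strategy: reject if and only if at least `ℓ` of the previous primary
allocations were to the suggested bin. -/
noncomputable def thresholdStrategy (n : ℕ) (ℓ : ℝ) : Strategy n :=
  fun h m => decide (ℓ ≤ (primaryCount h m : ℝ))

/-- `Z₀ 0, Z₀ 1, …, Z₁ 0, Z₁ 1, …` are mutually independent random variables, uniformly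
distributed on the `n` bins, on the probability space `(Ω, P)`. -/
structure IsUniformSource {n : ℕ} {Ω : Type*} [MeasurableSpace Ω] (P : Measure Ω)
    (Z₀ Z₁ : ℕ → Ω → Fin n) : Prop where
  isProbabilityMeasure : IsProbabilityMeasure P
  measurable₀ : ∀ t, Measurable (Z₀ t)
  measurable₁ : ∀ t, Measurable (Z₁ t)
  indep : iIndepFun (Sum.elim Z₀ Z₁) P
  uniform₀ : ∀ t m, P.real {ω | Z₀ t ω = m} = 1 / n
  uniform₁ : ∀ t m, P.real {ω | Z₁ t ω = m} = 1 / n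

/-- The random maximum load after `⌊ρ n⌋` balls. -/
noncomputable def randomMaxLoad {n : ℕ} {Ω : Type*} (Z₀ Z₁ : ℕ → Ω → Fin n) (ρ : ℝ) (f : Strategy n)
    (ω : Ω) : ℕ :=
  maxLoad f (fun t => Z₀ t ω) (fun t => Z₁ t ω) ⌊ρ * n⌋₊

/-- The event `E n` has probability tending to `1` as `n → ∞`. -/
def WithHighProbability {Ω : ℕ → Type*} [∀ n, MeasurableSpace (Ω n)]
    (P : ∀ n, Measure (Ω n)) (E : ∀ n, Set (Ω n)) : Prop :=
  Tendsto (fun n => (P n).real (E n)) atTop (𝓝 1)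

/-- The family `f` of strategies (one for each number of bins) is asymptotically optimal: for every
family `g` of strategies, the maximum load under `f` is at most `1 + o(1)` times that under `g`,
with high probability. -/
def AsymptoticallyOptimal {Ω : ℕ → Type*} [∀ n, MeasurableSpace (Ω n)]
    (P : ∀ n, Measure (Ω n)) (Z₀ Z₁ : ∀ n, ℕ → Ω n → Fin n) (ρ : ℝ)
    (f : ∀ n, Strategy n) : Prop :=
  ∀ g : ∀ n, Strategy n, ∀ ε : ℝ, 0 < ε →
    WithHighProbability P fun n =>
      {ω | (randomMaxLoad (Z₀ n) (Z₁ n) ρ (f n) ω : ℝ) ≤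
        (1 + ε) * (randomMaxLoad (Z₀ n) (Z₁ n) ρ (g n) ω : ℝ)}

end TwoThinning

/-! Write L for `threshold n` and A for `decayRate n`, so that n = exp (L A). The threshold is
chosen to make L log L asymptotic to A, while L / A tends to 0. Consequently, among order n uniform
balls, about n exp (-b A) bins receive b L balls, up to factors exp (o(A)).

Upper bound. The threshold strategy leaves at most about L primary balls in a bin. A first moment
bound shows that it makes fewer than n exp (-(1-τ) A) rejections. Some bin receives j of that many
secondary balls with probability at most exp (L A - j (1-τ) A), which vanishes for j = (1+δ) L once
(1-τ)(1+δ) > 1. The maximum is therefore at most about 2 L, which is √(8 log n / log log n). This is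
`tendsto_measureReal_maxLoad_thresholdStrategy_gt`.

Lower bound. Against an arbitrary strategy, split the balls into S equal periods and let a grow in S
steps from 0 to 2. The invariant is that at the end of a period about n exp (-a A) bins have load at
least about a L. In the next period, with next level a', there are two cases. If there are at least
n exp (-a' A) rejections, the secondary balls put about L / a' more into one of the bins of load a
L. Its load a L + L / a' is at least about 2 L, since a + 1 / a ≥ 2. If there are fewer, rejections
cannot spoil all the bins that receive a' L primary balls in the period, and the invariant survives.
At a = 2 it gives load 2 L itself. The combinatorial part is `le_maxLoad_of_periods`. Its
probabilistic inputs are a second moment estimate, `measureReal_few_bins_le`, and the independence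
of unused secondary entries from the past, `measureReal_restart_le`. Together they give
`tendsto_measureReal_maxLoad_lt`. -/

namespace TwoThinning

/-! ### First and second moment inequalities for counting events. -/

section Moments

variable {Ω β : Type*}

lemma card_filter_eq_sum_indicator (B : Finset β) (E : β → Set Ω)
    [∀ ω, DecidablePred fun b => ω ∈ E b] (ω : Ω) :
    ((B.filter fun b => ω ∈ E b).card : ℝ) = ∑ b ∈ B, (E b).indicator (fun _ => (1 : ℝ)) ω := by
  simp [Set.indicator_apply]

variable [MeasurableSpace Ω] {P : Measure Ω}

/-- Markov's inequality for the number of events that occur. -/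
lemma measureReal_le_card_filter [IsProbabilityMeasure P] (B : Finset β) (E : β → Set Ω)
    [∀ ω, DecidablePred fun b => ω ∈ E b] (hE : ∀ b ∈ B, MeasurableSet (E b)) (p : ℝ) (hp : ∀ b ∈ B, P.real (E b) ≤ p) {x : ℝ}
    (hx : 0 < x) :
    P.real {ω | x ≤ ((B.filter fun b => ω ∈ E b).card : ℝ)} ≤ B.card * p / x := by
  have hi : ∀ b ∈ B, Integrable ((E b).indicator (fun _ => (1 : ℝ))) P := fun b hb =>
    (integrable_const 1).indicator (hE b hb)
  have h := mul_meas_ge_le_integral_of_nonneg (μ := P)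
    (f := fun ω => ((B.filter fun b => ω ∈ E b).card : ℝ))
    (Eventually.of_forall fun ω => Nat.cast_nonneg _)
    (by simp_rw [card_filter_eq_sum_indicator]; exact integrable_finsetSum _ hi) x
  have h2 : ∫ ω, ((B.filter fun b => ω ∈ E b).card : ℝ) ∂P ≤ B.card * p := by
    simp_rw [card_filter_eq_sum_indicator]
    rw [integral_finsetSum _ hi]
    calc _ = ∑ b ∈ B, P.real (E b) := Finset.sum_congr rfl fun b hb => by
            rw [integral_indicator (hE b hb)]; simp
      _ ≤ ∑ _b ∈ B, p := Finset.sum_le_sum hp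
      _ = _ := by simp
  rw [le_div_iff₀ hx, mul_comm]
  exact h.trans h2

/-- Chebyshev's inequality for the number of events that occur, for almost negatively correlated
events of equal probability. -/
lemma measureReal_card_filter_le_half [IsProbabilityMeasure P] (B : Finset β) (E : β → Set Ω)
    [∀ ω, DecidablePred fun b => ω ∈ E b] (hE : ∀ b ∈ B, MeasurableSet (E b)) {p θ : ℝ} (hp0 : 0 < p) (hB : B.Nonempty) (hθ : 0 ≤ θ)
    (hp : ∀ b ∈ B, P.real (E b) = p)
    (hpair : ∀ b ∈ B, ∀ c ∈ B, b ≠ c → P.real (E b ∩ E c) ≤ p ^ 2 * (1 + θ)) :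
    P.real {ω | ((B.filter fun b => ω ∈ E b).card : ℝ) ≤ B.card * p / 2} ≤
      4 / (B.card * p) + 4 * θ := by
  classical
  set X : Ω → ℝ := fun ω => ((B.filter fun b => ω ∈ E b).card : ℝ) with hX
  set μ : ℝ := B.card * p with hμ
  have hμ0 : 0 < μ := by have := hB.card_pos; positivity
  have hXs : X = fun ω => ∑ b ∈ B, (E b).indicator (fun _ => (1 : ℝ)) ω := by
    funext ω; exact card_filter_eq_sum_indicator B E ω
  have hi : ∀ b ∈ B, Integrable ((E b).indicator (fun _ => (1 : ℝ))) P := fun b hb =>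
    (integrable_const 1).indicator (hE b hb)
  have hXint : Integrable X P := by rw [hXs]; exact integrable_finsetSum _ hi
  have hEX : ∫ ω, X ω ∂P = μ := by
    rw [hXs, integral_finsetSum _ hi]
    calc _ = ∑ b ∈ B, P.real (E b) := Finset.sum_congr rfl fun b hb => by
            rw [integral_indicator (hE b hb)]; simp
      _ = ∑ _b ∈ B, p := Finset.sum_congr rfl hp
      _ = _ := by simp [hμ]
  have hX2 : (fun ω => X ω ^ 2) =
      fun ω => ∑ b ∈ B, ∑ c ∈ B, (E b ∩ E c).indicator (fun _ => (1 : ℝ)) ω := by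
    funext ω
    rw [hXs]
    simp only
    rw [sq, Finset.sum_mul_sum]
    refine Finset.sum_congr rfl fun b _ => Finset.sum_congr rfl fun c _ => ?_
    rw [← Set.inter_indicator_mul, one_mul]
  have hi2 : ∀ b ∈ B, ∀ c ∈ B, Integrable ((E b ∩ E c).indicator (fun _ => (1 : ℝ))) P :=
    fun b hb c hc => (integrable_const 1).indicator ((hE b hb).inter (hE c hc))
  have hX2int : Integrable (fun ω => X ω ^ 2) P := by
    rw [hX2]
    exact integrable_finsetSum _ fun b hb => integrable_finsetSum _ fun c hc => hi2 b hb c hc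
  have hEX2 : ∫ ω, X ω ^ 2 ∂P ≤ μ + μ ^ 2 * (1 + θ) := by
    rw [hX2, integral_finsetSum _ fun b hb => integrable_finsetSum _ fun c hc => hi2 b hb c hc]
    calc _ = ∑ b ∈ B, ∑ c ∈ B, P.real (E b ∩ E c) := by
            refine Finset.sum_congr rfl fun b hb => ?_
            rw [integral_finsetSum _ fun c hc => hi2 b hb c hc]
            refine Finset.sum_congr rfl fun c hc => ?_
            rw [integral_indicator ((hE b hb).inter (hE c hc))]; simp
      -- The pair bound is also added on the diagonal, where it is not needed, so that the double
      -- sum evaluates to μ + μ ^ 2 * (1 + θ).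
      _ ≤ ∑ b ∈ B, ∑ c ∈ B, ((if b = c then p else 0) + p ^ 2 * (1 + θ)) := by
            refine Finset.sum_le_sum fun b hb => Finset.sum_le_sum fun c hc => ?_
            split_ifs with hbc
            · subst hbc
              rw [Set.inter_self, hp b hb]
              have : 0 ≤ p ^ 2 * (1 + θ) := by positivity
              linarith
            · rw [zero_add]; exact hpair b hb c hc hbc
      _ = _ := by
            simp only [Finset.sum_add_distrib, Finset.sum_ite_eq, Finset.sum_const, nsmul_eq_mul,
              Finset.sum_ite_mem, Finset.inter_self, hμ]
            ring
  have hsub : {ω | X ω ≤ μ / 2} ⊆ {ω | μ ^ 2 / 4 ≤ (X ω - μ) ^ 2} := fun ω hω => by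
    simp only [Set.mem_ofPred_eq] at hω ⊢
    nlinarith
  have hvar : ∫ ω, (X ω - μ) ^ 2 ∂P ≤ μ + μ ^ 2 * θ := by
    have : (fun ω => (X ω - μ) ^ 2) = fun ω => (X ω ^ 2 - 2 * μ * X ω) + μ ^ 2 := by
      funext ω; ring
    have hsubint : Integrable (fun ω => X ω ^ 2 - 2 * μ * X ω) P := hX2int.sub (hXint.const_mul _)
    rw [this, integral_add hsubint (integrable_const _),
      integral_sub hX2int (hXint.const_mul _), integral_const_mul, hEX]
    simp only [integral_const, probReal_univ, smul_eq_mul]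
    linarith
  have hvint : Integrable (fun ω => (X ω - μ) ^ 2) P := by
    have : (fun ω => (X ω - μ) ^ 2) = fun ω => (X ω ^ 2 - 2 * μ * X ω) + μ ^ 2 := by
      funext ω; ring
    rw [this]
    exact (hX2int.sub (hXint.const_mul _)).add (integrable_const _)
  have h := mul_meas_ge_le_integral_of_nonneg (μ := P) (f := fun ω => (X ω - μ) ^ 2)
    (Eventually.of_forall fun ω => sq_nonneg _) hvint (μ ^ 2 / 4)
  have h3 : P.real {ω | X ω ≤ μ / 2} ≤ P.real {ω | μ ^ 2 / 4 ≤ (X ω - μ) ^ 2} :=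
    measureReal_mono hsub
  have h4 : μ ^ 2 / 4 * P.real {ω | X ω ≤ μ / 2} ≤ μ + μ ^ 2 * θ :=
    (mul_le_mul_of_nonneg_left h3 (by positivity)).trans (h.trans hvar)
  have h5 : 4 / μ + 4 * θ = (μ + μ ^ 2 * θ) / (μ ^ 2 / 4) := by field_simp
  rw [h5, le_div_iff₀ (by positivity)]
  linarith

end Moments

section HighProbability

variable {Ω : ℕ → Type*} [∀ n, MeasurableSpace (Ω n)] {P : ∀ n, Measure (Ω n)}
  {E : ∀ n, Set (Ω n)}

/-- Subadditivity gives 1 ≤ P(E) + P(Eᶜ) even for non-measurable E, so no measurability of the load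
events has to be proved. -/
lemma WithHighProbability.of_compl_le (hP : ∀ᶠ n in atTop, IsProbabilityMeasure (P n))
    {b : ℕ → ℝ} (hb : Tendsto b atTop (𝓝 0)) (h : ∀ᶠ n in atTop, (P n).real (E n)ᶜ ≤ b n) :
    WithHighProbability P E := by
  refine tendsto_of_tendsto_of_tendsto_of_le_of_le' (g := fun n => 1 - b n) (h := fun _ => 1)
    (by simpa using hb.const_sub 1) tendsto_const_nhds ?_ ?_
  · filter_upwards [hP, h] with n h1 h2
    have := measureReal_union_le (μ := P n) (E n) (E n)ᶜ
    rw [Set.union_compl_self, probReal_univ] at this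
    linarith
  · filter_upwards [hP] with n h1
    exact measureReal_le_one

end HighProbability

/-! ### Occupancy of bins by independent uniform balls. -/

/-- A sequence of independent, uniformly distributed random bins. -/
structure IsUniformSequence {n : ℕ} {Ω : Type*} [MeasurableSpace Ω] (P : Measure Ω)
    (Y : ℕ → Ω → Fin n) : Prop where
  isProbabilityMeasure : IsProbabilityMeasure P
  measurable : ∀ i, Measurable (Y i)
  indep : iIndepFun Y P
  uniform : ∀ i m, P.real {ω | Y i ω = m} = 1 / n

lemma IsUniformSource.primary {n : ℕ} {Ω : Type*} [MeasurableSpace Ω] {P : Measure Ω}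
    {Z₀ Z₁ : ℕ → Ω → Fin n} (h : IsUniformSource P Z₀ Z₁) : IsUniformSequence P Z₀ where
  isProbabilityMeasure := h.isProbabilityMeasure
  measurable := h.measurable₀
  indep := iIndepFun.precomp (g := Sum.inl) Sum.inl_injective h.indep
  uniform := h.uniform₀

lemma IsUniformSource.secondary {n : ℕ} {Ω : Type*} [MeasurableSpace Ω] {P : Measure Ω}
    {Z₀ Z₁ : ℕ → Ω → Fin n} (h : IsUniformSource P Z₀ Z₁) : IsUniformSequence P Z₁ where
  isProbabilityMeasure := h.isProbabilityMeasure
  measurable := h.measurable₁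
  indep := iIndepFun.precomp (g := Sum.inr) Sum.inr_injective h.indep
  uniform := h.uniform₁

/-- The set of indices in `I` at which the sequence `y` hits the bin `m`. -/
def hits {n : ℕ} (y : ℕ → Fin n) (I : Finset ℕ) (m : Fin n) : Finset ℕ := I.filter fun i => y i = m

/-- Induction on j: the binomial coefficient picks up the factor (K+1)/(j+1), and this is at most
K/j when j ≤ K, so the remaining factors only improve. -/
lemma div_pow_le_choose : ∀ (j K : ℕ), j ≤ K → ((K : ℝ) / j) ^ j ≤ (K.choose j : ℝ)
  | 0, K, _ => by simp
  | j + 1, 0, h => by omega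
  | j + 1, K + 1, h => by
    have h1 := div_pow_le_choose j K (by omega)
    have h2 : ((K + 1).choose (j + 1) : ℝ) = ((K + 1 : ℕ) : ℝ) / ((j + 1 : ℕ) : ℝ) * K.choose j := by
      have := Nat.add_one_mul_choose_eq K j
      have h3 : (((K + 1) * K.choose j : ℕ) : ℝ) = (((K + 1).choose (j + 1) * (j + 1) : ℕ) : ℝ) := by
        rw [this]
      push_cast at h3 ⊢
      field_simp
      linarith
    rw [h2, pow_succ, mul_comm]
    refine mul_le_mul_of_nonneg_left (le_trans ?_ h1) (by positivity)
    rcases Nat.eq_zero_or_pos j with rfl | hj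
    · simp
    · refine pow_le_pow_left₀ (by positivity) ?_ _
      have hjK : (j : ℝ) ≤ K := by exact_mod_cast (by omega : j ≤ K)
      have hj0 : (0 : ℝ) < j := by exact_mod_cast hj
      rw [div_le_div_iff₀ (by positivity) hj0]
      push_cast
      nlinarith

section Occupancy

variable {n : ℕ} {Ω : Type*} [MeasurableSpace Ω] {P : Measure Ω} {Y : ℕ → Ω → Fin n}

namespace IsUniformSequence

variable (hY : IsUniformSequence P Y)
include hY

lemma measureReal_mem (i : ℕ) (A : Finset (Fin n)) :
    P.real {ω | Y i ω ∈ A} = A.card / n := by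
  have := hY.isProbabilityMeasure
  have h : {ω | Y i ω ∈ A} = ⋃ m ∈ A, {ω | Y i ω = m} := by ext; simp
  rw [h, measureReal_biUnion_finset]
  · simp only [hY.uniform, Finset.sum_const, nsmul_eq_mul]; ring
  · intro a _ b _ hab
    refine Set.disjoint_left.2 fun ω h1 h2 => hab ?_
    exact h1.symm.trans h2
  · exact fun m _ => hY.measurable i (measurableSet_singleton m)

lemma measureReal_forall_mem (I : Finset ℕ) (A : ℕ → Finset (Fin n)) :
    P.real {ω | ∀ i ∈ I, Y i ω ∈ A i} = ∏ i ∈ I, ((A i).card / n : ℝ) := by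
  have h := hY.indep.measure_inter_preimage_eq_mul I (sets := fun i => (A i : Set (Fin n)))
    fun i _ => (A i).measurableSet
  have h2 : {ω | ∀ i ∈ I, Y i ω ∈ A i} = ⋂ i ∈ I, Y i ⁻¹' (A i : Set (Fin n)) := by ext; simp
  rw [h2, measureReal_def, h, ENNReal.toReal_prod]
  exact Finset.prod_congr rfl fun i _ => hY.measureReal_mem i (A i)

/-- Only the finitely many coordinates in `I` matter, and every subset of the finite type `I → Fin
n` is measurable. -/
lemma measurableSet_hits_eq (I S : Finset ℕ) (m : Fin n) :
    MeasurableSet {ω | hits (fun i => Y i ω) I m = S} := by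
  have h : {ω | hits (fun i => Y i ω) I m = S} =
      {ω | (fun i : I => Y i ω) ∈ {x : I → Fin n | ∀ k, (∃ h : k ∈ I, x ⟨k, h⟩ = m) ↔ k ∈ S}} := by
    ext ω
    simp [hits, Finset.ext_iff]
  rw [h]
  exact (measurable_pi_lambda _ fun i : I => hY.measurable i)
    (Set.Finite.measurableSet (Set.toFinite _))

lemma measurableSet_card_hits (I : Finset ℕ) (m : Fin n) (j : ℕ) :
    MeasurableSet {ω | (hits (fun i => Y i ω) I m).card = j} := by
  have h : {ω | (hits (fun i => Y i ω) I m).card = j} =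
      ⋃ S ∈ I.powersetCard j, {ω | hits (fun i => Y i ω) I m = S} := by
    ext ω
    simp [hits, Finset.mem_powersetCard]
  rw [h]
  exact Finset.measurableSet_biUnion _ fun S _ => hY.measurableSet_hits_eq I S m

lemma measureReal_hits_eq (hn : 1 ≤ n) {I S : Finset ℕ} (hS : S ⊆ I) (m : Fin n) :
    P.real {ω | hits (fun i => Y i ω) I m = S} =
      (1 / n : ℝ) ^ S.card * (1 - 1 / n) ^ (I.card - S.card) := by
  have h : {ω | hits (fun i => Y i ω) I m = S} =
      {ω | ∀ i ∈ I, Y i ω ∈ (if i ∈ S then {m} else {m}ᶜ : Finset (Fin n))} := by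
    ext ω
    simp only [hits, Finset.ext_iff, Finset.mem_filter, Set.mem_ofPred_eq]
    refine forall_congr' fun i => ?_
    by_cases hi : i ∈ S
    · simp [hi, hS hi]
    · simp [hi]
  have hn0 : (n : ℝ) ≠ 0 := by positivity
  rw [h, hY.measureReal_forall_mem, ← Finset.sdiff_union_of_subset hS,
    Finset.prod_union Finset.sdiff_disjoint, Finset.sdiff_union_of_subset hS, mul_comm]
  congr 1
  · rw [Finset.prod_congr rfl (g := fun _ => (1 / n : ℝ)), Finset.prod_const]
    intro i hi; simp [hi]
  · rw [Finset.prod_congr rfl (g := fun _ => (1 - 1 / n : ℝ)), Finset.prod_const,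
      Finset.card_sdiff_of_subset hS]
    intro i hi
    rw [if_neg (Finset.mem_sdiff.1 hi).2, Finset.card_compl]
    simp only [Fintype.card_fin, Finset.card_singleton, Nat.cast_sub hn, Nat.cast_one]
    field_simp

/-- Two bins cannot share a ball, so the event is empty unless S and T are disjoint. Then the other
|I| - 2j balls avoid both bins, and 1 - 2/n ≤ (1 - 1/n)^2 compares this with independence. The
inverse factor accounts for the exponent 2(|I| - 2j) in place of 2(|I| - j). -/
lemma measureReal_hits_eq_inter_le (hn : 2 ≤ n) {I S T : Finset ℕ} {j : ℕ}
    (hS : S ∈ I.powersetCard j) (hT : T ∈ I.powersetCard j) {m m' : Fin n} (hm : m ≠ m') :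
    P.real ({ω | hits (fun i => Y i ω) I m = S} ∩ {ω | hits (fun i => Y i ω) I m' = T}) ≤
      ((1 / n : ℝ) ^ j * (1 - 1 / n) ^ (I.card - j)) ^ 2 * ((1 - 1 / n : ℝ) ^ (2 * j))⁻¹ := by
  have := hY.isProbabilityMeasure
  obtain ⟨hSI, hSj⟩ := Finset.mem_powersetCard.1 hS
  obtain ⟨hTI, hTj⟩ := Finset.mem_powersetCard.1 hT
  have hn0 : (0 : ℝ) < n := by positivity
  have hn2 : (2 : ℝ) ≤ n := by exact_mod_cast hn
  have hq : (0 : ℝ) < 1 - 1 / n := by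
    rw [sub_pos, div_lt_one hn0]; linarith
  have hq2 : (0 : ℝ) ≤ 1 - 2 / n := by
    rw [sub_nonneg, div_le_one hn0]; linarith
  by_cases hST : Disjoint S T
  · have hU : S ∪ T ⊆ I := Finset.union_subset hSI hTI
    have hUc : (S ∪ T).card = 2 * j := by rw [Finset.card_union_of_disjoint hST]; omega
    have h2j : 2 * j ≤ I.card := hUc ▸ Finset.card_le_card hU
    have hsub : {ω | hits (fun i => Y i ω) I m = S} ∩ {ω | hits (fun i => Y i ω) I m' = T} ⊆
        {ω | ∀ i ∈ I, Y i ω ∈ (if i ∈ S then {m} else if i ∈ T then {m'} else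
          {m, m'}ᶜ : Finset (Fin n))} := by
      rintro ω ⟨h1, h2⟩ i hi
      simp only [hits, Finset.ext_iff, Finset.mem_filter, Set.mem_ofPred_eq] at h1 h2
      have h1 := h1 i
      have h2 := h2 i
      simp only [hi, true_and] at h1 h2
      split_ifs with h3 h4 <;> simp_all
    refine (measureReal_mono hsub (measure_ne_top _ _)).trans ?_
    rw [hY.measureReal_forall_mem, ← Finset.sdiff_union_of_subset hU,
      Finset.prod_union Finset.sdiff_disjoint, Finset.sdiff_union_of_subset hU]
    have e1 : ∏ i ∈ S ∪ T, (((if i ∈ S then {m} else if i ∈ T then {m'} else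
        {m, m'}ᶜ : Finset (Fin n)).card : ℝ) / n) = (1 / n : ℝ) ^ (2 * j) := by
      rw [Finset.prod_congr rfl (g := fun _ => (1 / n : ℝ)), Finset.prod_const, hUc]
      intro i hi
      rcases Finset.mem_union.1 hi with h | h
      · simp [h]
      · by_cases h' : i ∈ S <;> simp [h, h']
    have e2 : ∏ i ∈ I \ (S ∪ T), (((if i ∈ S then {m} else if i ∈ T then {m'} else
        {m, m'}ᶜ : Finset (Fin n)).card : ℝ) / n) = (1 - 2 / n : ℝ) ^ (I.card - 2 * j) := by
      rw [Finset.prod_congr rfl (g := fun _ => (1 - 2 / n : ℝ)), Finset.prod_const,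
        Finset.card_sdiff_of_subset hU, hUc]
      intro i hi
      simp only [Finset.mem_sdiff, Finset.mem_union, not_or] at hi
      rw [if_neg hi.2.1, if_neg hi.2.2, Finset.card_compl, Finset.card_pair hm]
      simp only [Fintype.card_fin, Nat.cast_sub hn]
      field_simp
      simp
    rw [e1, e2, mul_pow, ← pow_mul, ← pow_mul, mul_comm j 2, mul_comm, mul_assoc]
    refine mul_le_mul_of_nonneg_left ?_ (by positivity)
    have e3 : ((1 : ℝ) - 1 / n) ^ ((I.card - j) * 2) * ((1 - 1 / n : ℝ) ^ (2 * j))⁻¹ =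
        ((1 - 1 / n) ^ 2) ^ (I.card - 2 * j) := by
      rw [mul_inv_eq_iff_eq_mul₀ (by positivity), ← pow_mul, ← pow_add]
      congr 1; omega
    rw [e3]
    refine pow_le_pow_left₀ hq2 ?_ _
    have : (0 : ℝ) ≤ (1 / n) ^ 2 := by positivity
    have h2 : (2 / n : ℝ) = 2 * (1 / n) := by ring
    rw [h2]; nlinarith
  · have hempty : {ω | hits (fun i => Y i ω) I m = S} ∩ {ω | hits (fun i => Y i ω) I m' = T} =
        ∅ := by
      refine Set.eq_empty_of_forall_notMem ?_
      rintro ω ⟨h1, h2⟩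
      refine hST ?_
      rw [← h1, ← h2]
      refine Finset.disjoint_left.2 fun i hi hi' => hm ?_
      simp only [hits, Finset.mem_filter] at hi hi'
      exact hi.2.symm.trans hi'.2
    rw [hempty]
    simp only [measureReal_empty]
    positivity

lemma measureReal_card_hits (hn : 1 ≤ n) (I : Finset ℕ) (m : Fin n) (j : ℕ) :
    P.real {ω | (hits (fun i => Y i ω) I m).card = j} =
      I.card.choose j * ((1 / n : ℝ) ^ j * (1 - 1 / n) ^ (I.card - j)) := by
  have := hY.isProbabilityMeasure
  have h : {ω | (hits (fun i => Y i ω) I m).card = j} =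
      ⋃ S ∈ I.powersetCard j, {ω | hits (fun i => Y i ω) I m = S} := by
    ext ω
    simp [hits, Finset.mem_powersetCard]
  rw [h, measureReal_biUnion_finset]
  · rw [Finset.sum_congr rfl (g := fun _ => (1 / n : ℝ) ^ j * (1 - 1 / n) ^ (I.card - j)),
      Finset.sum_const, Finset.card_powersetCard, nsmul_eq_mul]
    intro S hS
    obtain ⟨h1, h2⟩ := Finset.mem_powersetCard.1 hS
    rw [hY.measureReal_hits_eq hn h1, h2]
  · intro a _ b _ hab
    refine Set.disjoint_left.2 fun ω h1 h2 => hab ?_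
    exact h1.symm.trans h2
  · exact fun S _ => hY.measurableSet_hits_eq I S m

lemma measureReal_card_hits_inter_le (hn : 2 ≤ n) (I : Finset ℕ) {m m' : Fin n} (hm : m ≠ m')
    (j : ℕ) :
    P.real ({ω | (hits (fun i => Y i ω) I m).card = j} ∩
        {ω | (hits (fun i => Y i ω) I m').card = j}) ≤
      (I.card.choose j * ((1 / n : ℝ) ^ j * (1 - 1 / n) ^ (I.card - j))) ^ 2 *
        ((1 - 1 / n : ℝ) ^ (2 * j))⁻¹ := by
  have := hY.isProbabilityMeasure
  have h : {ω | (hits (fun i => Y i ω) I m).card = j} ∩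
        {ω | (hits (fun i => Y i ω) I m').card = j} =
      ⋃ S ∈ I.powersetCard j ×ˢ I.powersetCard j, ({ω | hits (fun i => Y i ω) I m = S.1} ∩
        {ω | hits (fun i => Y i ω) I m' = S.2}) := by
    ext ω
    simp [hits, Finset.mem_powersetCard]
  rw [h]
  refine (measureReal_biUnion_finset_le _ _).trans ?_
  refine (Finset.sum_le_card_nsmul _ _ (((1 / n : ℝ) ^ j * (1 - 1 / n) ^ (I.card - j)) ^ 2 *
        ((1 - 1 / n : ℝ) ^ (2 * j))⁻¹) ?_).trans ?_
  · intro S hS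
    obtain ⟨h1, h2⟩ := Finset.mem_product.1 hS
    exact hY.measureReal_hits_eq_inter_le hn h1 h2 hm
  · rw [Finset.card_product, Finset.card_powersetCard, nsmul_eq_mul]
    push_cast
    apply le_of_eq
    ring

/-- Among the bins in `B`, many are hit at least `j` times. -/
theorem measureReal_few_bins_le (hn : 2 ≤ n) (B : Finset (Fin n)) (hB : B.Nonempty)
    (I : Finset ℕ) {j : ℕ} (hj : j ≤ I.card) (hjn : 4 * j ≤ n) {v : ℝ} (hv : 0 < v)
    (hvB : 2 * v ≤ B.card * ((I.card / (j * n) : ℝ) ^ j * Real.exp (-(2 * I.card / n)))) :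
    P.real {ω | ((B.filter fun m => j ≤ (hits (fun i => Y i ω) I m).card).card : ℝ) ≤ v} ≤
      2 / v + 16 * j / n := by
  have := hY.isProbabilityMeasure
  have hn0 : (0 : ℝ) < n := by positivity
  have hn2 : (2 : ℝ) ≤ n := by exact_mod_cast hn
  have hx : (1 / n : ℝ) ≤ 1 / 2 := by
    rw [div_le_div_iff₀ hn0 two_pos]; linarith
  have hq : (0 : ℝ) < 1 - 1 / n := by linarith
  set p : ℝ := I.card.choose j * ((1 / n : ℝ) ^ j * (1 - 1 / n) ^ (I.card - j)) with hp
  set θ : ℝ := ((1 - 1 / n : ℝ) ^ (2 * j))⁻¹ - 1 with hθ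
  have hp0 : 0 < p := by
    have := Nat.choose_pos hj
    positivity
  -- Bernoulli's inequality; with 4j ≤ n it makes the correlation error θ at most 4j/n.
  have hpow : 1 - 2 * j / n ≤ (1 - 1 / n : ℝ) ^ (2 * j) := by
    have := one_add_mul_le_pow (a := (-(1 / n) : ℝ)) (by linarith) (2 * j)
    push_cast at this
    calc _ = 1 + 2 * (j : ℝ) * -(1 / n) := by ring
      _ ≤ _ := this
      _ = _ := by ring
  have hjn' : 4 * (j : ℝ) ≤ n := by exact_mod_cast hjn
  have hjn2 : 2 * j / n ≤ (1 / 2 : ℝ) := by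
    rw [div_le_div_iff₀ hn0 two_pos]; linarith
  have hθ0 : 0 ≤ θ := by
    rw [hθ, sub_nonneg]
    exact (one_le_inv₀ (by positivity)).2 (pow_le_one₀ hq.le (by simp))
  have hθ1 : θ ≤ 4 * j / n := by
    have h0 : (0 : ℝ) ≤ 2 * j / n := by positivity
    have h1 : ((1 - 1 / n : ℝ) ^ (2 * j))⁻¹ ≤ (1 - 2 * j / n : ℝ)⁻¹ :=
      inv_anti₀ (by linarith) hpow
    have h2 : (1 - 2 * j / n : ℝ)⁻¹ ≤ 1 + 2 * (2 * j / n) := by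
      rw [inv_le_iff_one_le_mul₀ (by linarith)]
      nlinarith
    calc θ ≤ 2 * (2 * j / n) := by rw [hθ]; linarith
      _ = _ := by ring
  have hpl : (I.card / (j * n) : ℝ) ^ j * Real.exp (-(2 * I.card / n)) ≤ p := by
    have h1 := div_pow_le_choose j I.card hj
    have h2 : (I.card / (j * n) : ℝ) ^ j = (I.card / j : ℝ) ^ j * (1 / n) ^ j := by
      rw [← mul_pow]; congr 1; field_simp
    have h3 : Real.exp (-(2 * I.card / n)) ≤ (1 - 1 / n : ℝ) ^ (I.card - j) := by
      have h4 : Real.exp (-(2 / n)) ≤ (1 - 1 / n : ℝ) := by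
        have h5 := Real.add_one_le_exp (2 / n : ℝ)
        rw [Real.exp_neg, inv_le_iff_one_le_mul₀ (Real.exp_pos _)]
        have h6 : (2 / n : ℝ) = 2 * (1 / n) := by ring
        have h7 : (0 : ℝ) < 1 / n := by positivity
        calc (1 : ℝ) ≤ (1 - 1 / n) * (2 / n + 1) := by rw [h6]; nlinarith
          _ ≤ _ := mul_le_mul_of_nonneg_left h5 hq.le
      calc Real.exp (-(2 * I.card / n)) = Real.exp (-(2 / n)) ^ I.card := by
            rw [← Real.exp_nat_mul]; congr 1; ring
        _ ≤ (1 - 1 / n : ℝ) ^ I.card := pow_le_pow_left₀ (Real.exp_pos _).le h4 _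
        _ ≤ _ := pow_le_pow_of_le_one hq.le (by linarith [show (0:ℝ) < 1 / n by positivity])
            (Nat.sub_le _ _)
    rw [h2, mul_assoc, hp]
    gcongr
  have hvp : 2 * v ≤ B.card * p := hvB.trans (by gcongr)
  -- The second moment method is applied to exactly j hits, whose probabilities are explicit; this
  -- only undercounts the bins with at least j hits.
  have key := measureReal_card_filter_le_half (P := P) B
    (fun m => {ω | (hits (fun i => Y i ω) I m).card = j})
    (fun m _ => hY.measurableSet_card_hits I m j) hp0 hB hθ0
    (fun m _ => hY.measureReal_card_hits (by omega) I m j)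
    (fun m _ m' _ hmm => by
      rw [hθ, add_sub_cancel]
      exact hY.measureReal_card_hits_inter_le hn I hmm j)
  refine (measureReal_mono ?_).trans (key.trans ?_)
  · intro ω hω
    simp only [Set.mem_ofPred_eq] at hω ⊢
    refine le_trans ?_ (hω.trans (by linarith))
    refine Nat.cast_le.2 (Finset.card_le_card fun m => ?_)
    simp only [Finset.mem_filter]
    exact fun h => ⟨h.1, h.2.ge⟩
  · have h1 : 4 / (B.card * p) ≤ 2 / v := by
      rw [div_le_div_iff₀ (by linarith) hv]; linarith
    have h2 : 4 * θ ≤ 16 * j / n := by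
      calc 4 * θ ≤ 4 * (4 * j / n) := by linarith
        _ = _ := by ring
    linarith

/-- Union bound for some bin being hit `j` times. -/
theorem measureReal_exists_le_card_hits (hn : 1 ≤ n) (I : Finset ℕ) (j : ℕ) :
    P.real {ω | ∃ m, j ≤ (hits (fun i => Y i ω) I m).card} ≤ n * (I.card / n : ℝ) ^ j := by
  have := hY.isProbabilityMeasure
  have hsub : {ω | ∃ m, j ≤ (hits (fun i => Y i ω) I m).card} ⊆
      ⋃ x ∈ (Finset.univ : Finset (Fin n)) ×ˢ I.powersetCard j,
        {ω | ∀ i ∈ x.2, Y i ω ∈ ({x.1} : Finset (Fin n))} := by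
    rintro ω ⟨m, hm⟩
    obtain ⟨S, hS, hc⟩ := Finset.exists_subset_card_eq hm
    simp only [Set.mem_iUnion]
    refine ⟨(m, S), ?_, ?_⟩
    · simp only [Finset.mem_product, Finset.mem_univ, Finset.mem_powersetCard, true_and]
      exact ⟨hS.trans (Finset.filter_subset _ _), hc⟩
    · intro i hi
      simpa using (Finset.mem_filter.1 (hS hi)).2
  refine (measureReal_mono hsub (measure_ne_top _ _)).trans ((measureReal_biUnion_finset_le _ _).trans ?_)
  rw [Finset.sum_congr rfl (g := fun _ => (1 / n : ℝ) ^ j), Finset.sum_const, nsmul_eq_mul,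
    Finset.card_product, Finset.card_powersetCard, Finset.card_univ, Fintype.card_fin]
  · push_cast
    rw [mul_assoc, div_pow, div_pow, one_pow, mul_one_div]
    gcongr
    exact_mod_cast Nat.choose_le_pow _ _
  · rintro ⟨m, S⟩ hx
    simp only [Finset.mem_product, Finset.mem_powersetCard] at hx
    rw [hY.measureReal_forall_mem]
    simp [hx.2.2]

/-- Bound for the probability that a ball is offered a bin that has been offered to at least `k`
of the `t` earlier balls. -/
lemma measureReal_repeated_primary_le (hn : 1 ≤ n) (t k : ℕ) :
    P.real {ω | k ≤ (hits (fun i => Y i ω) (Finset.range t) (Y t ω)).card} ≤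
      (t.choose k : ℝ) * (1 / n) ^ k := by
  have := hY.isProbabilityMeasure
  have hsub : {ω | k ≤ (hits (fun i => Y i ω) (Finset.range t) (Y t ω)).card} ⊆
      ⋃ x ∈ (Finset.univ : Finset (Fin n)) ×ˢ (Finset.range t).powersetCard k,
        {ω | ∀ i ∈ insert t x.2, Y i ω ∈ ({x.1} : Finset (Fin n))} := by
    intro ω hm
    obtain ⟨S, hS, hc⟩ := Finset.exists_subset_card_eq hm
    simp only [Set.mem_iUnion]
    refine ⟨(Y t ω, S), ?_, ?_⟩
    · simp only [Finset.mem_product, Finset.mem_univ, Finset.mem_powersetCard, true_and]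
      exact ⟨hS.trans (Finset.filter_subset _ _), hc⟩
    · intro i hi
      rcases Finset.mem_insert.1 hi with rfl | hi
      · simp
      · simpa using (Finset.mem_filter.1 (hS hi)).2
  refine (measureReal_mono hsub (measure_ne_top _ _)).trans ((measureReal_biUnion_finset_le _ _).trans ?_)
  -- Ball t together with the k earlier ones gives the exponent k + 1; the extra factor 1/n cancels
  -- the n choices of the common bin.
  rw [Finset.sum_congr rfl (g := fun _ => (1 / n : ℝ) ^ (k + 1)), Finset.sum_const, nsmul_eq_mul,
    Finset.card_product, Finset.card_powersetCard, Finset.card_univ, Fintype.card_fin,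
    Finset.card_range]
  · push_cast
    have hn0 : (n : ℝ) ≠ 0 := by positivity
    apply le_of_eq
    rw [pow_succ]
    field_simp
  · rintro ⟨m, S⟩ hx
    simp only [Finset.mem_product, Finset.mem_powersetCard] at hx
    rw [hY.measureReal_forall_mem]
    have : t ∉ S := fun h => by simpa using hx.2.1 h
    simp [hx.2.2, this]

end IsUniformSequence

end Occupancy

/-! ### Deterministic bookkeeping for loads and rejections. -/

section History

variable {n : ℕ} (f : Strategy n) (z₀ z₁ : ℕ → Fin n)

lemma history_succ (t : ℕ) : history f z₀ z₁ (t + 1) =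
    (z₀ t, if f (history f z₀ z₁ t) (z₀ t) then some (z₁ (rejections (history f z₀ z₁ t)))
      else none) :: history f z₀ z₁ t := rfl

lemma length_history (t : ℕ) : (history f z₀ z₁ t).length = t := by
  induction t with
  | zero => rfl
  | succ t ih => rw [history_succ, List.length_cons, ih]

lemma rejections_history_succ (t : ℕ) : rejections (history f z₀ z₁ (t + 1)) =
    rejections (history f z₀ z₁ t) + if f (history f z₀ z₁ t) (z₀ t) then 1 else 0 := by
  rw [history_succ]
  unfold rejections
  rw [List.countP_cons]
  split_ifs <;> simp_all

lemma load_history_succ (t : ℕ) (m : Fin n) : load (history f z₀ z₁ (t + 1)) m =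
    load (history f z₀ z₁ t) m +
      if f (history f z₀ z₁ t) (z₀ t) then
        (if z₁ (rejections (history f z₀ z₁ t)) = m then 1 else 0)
      else (if z₀ t = m then 1 else 0) := by
  rw [history_succ]
  unfold load
  rw [List.countP_cons]
  split_ifs <;> simp_all [Record.bin]

lemma card_hits_range_succ (y : ℕ → Fin n) (t : ℕ) (m : Fin n) :
    (hits y (Finset.range (t + 1)) m).card =
      (hits y (Finset.range t) m).card + if y t = m then 1 else 0 := by
  unfold hits
  rw [Finset.range_add_one, Finset.filter_insert]
  split_ifs <;> simp

lemma card_hits_Ico_succ (y : ℕ → Fin n) {s t : ℕ} (hst : s ≤ t) (m : Fin n) :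
    (hits y (Finset.Ico s (t + 1)) m).card =
      (hits y (Finset.Ico s t) m).card + if y t = m then 1 else 0 := by
  unfold hits
  rw [← Finset.insert_Ico_right_eq_Ico_add_one hst, Finset.filter_insert]
  split_ifs <;> simp

lemma primaryCount_history (t : ℕ) (m : Fin n) :
    primaryCount (history f z₀ z₁ t) m = (hits z₀ (Finset.range t) m).card := by
  induction t with
  | zero => rfl
  | succ t ih =>
    rw [card_hits_range_succ, ← ih, history_succ]
    unfold primaryCount
    rw [List.countP_cons]
    simp

lemma rejections_history_mono {s t : ℕ} (h : s ≤ t) :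
    rejections (history f z₀ z₁ s) ≤ rejections (history f z₀ z₁ t) := by
  refine monotone_nat_of_le_succ (f := fun t => rejections (history f z₀ z₁ t)) (fun t => ?_) h
  simp only [rejections_history_succ]
  omega

/-- The number of rejections, as the number of rejection times. -/
lemma rejections_history_eq_card (t : ℕ) : rejections (history f z₀ z₁ t) =
    ((Finset.range t).filter fun i => f (history f z₀ z₁ i) (z₀ i) = true).card := by
  induction t with
  | zero => rfl
  | succ t ih =>
    rw [rejections_history_succ, ih, Finset.range_add_one, Finset.filter_insert]
    split_ifs <;> simp

/-- After time `s`, all secondary allocations used increase the load. -/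
lemma load_add_card_hits_le {s t : ℕ} (hst : s ≤ t) (m : Fin n) :
    load (history f z₀ z₁ s) m + (hits z₁ (Finset.Ico (rejections (history f z₀ z₁ s))
      (rejections (history f z₀ z₁ t))) m).card ≤ load (history f z₀ z₁ t) m := by
  induction t, hst using Nat.le_induction with
  | base => simp [hits]
  | succ t hst ih =>
    rw [load_history_succ, rejections_history_succ]
    split_ifs <;>
      simp_all [card_hits_Ico_succ z₁ (rejections_history_mono f z₀ z₁ hst)] <;> omega

lemma load_history_mono {s t : ℕ} (hst : s ≤ t) (m : Fin n) :
    load (history f z₀ z₁ s) m ≤ load (history f z₀ z₁ t) m :=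
  (Nat.le_add_right _ _).trans (load_add_card_hits_le f z₀ z₁ hst m)

lemma load_le_maxLoad {s t : ℕ} (hst : s ≤ t) (m : Fin n) :
    load (history f z₀ z₁ s) m ≤ maxLoad f z₀ z₁ t :=
  (load_history_mono f z₀ z₁ hst m).trans
    (Finset.le_sup (f := fun m => load (history f z₀ z₁ t) m) (Finset.mem_univ m))

/-- Every primary allocation is either accepted or a rejection. -/
lemma card_hits_le_load_add {s t : ℕ} (hst : s ≤ t) (m : Fin n) :
    (hits z₀ (Finset.Ico s t) m).card ≤ load (history f z₀ z₁ t) m +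
      (((Finset.Ico s t).filter fun i => f (history f z₀ z₁ i) (z₀ i) = true).filter
        fun i => z₀ i = m).card := by
  induction t, hst using Nat.le_induction with
  | base => simp [hits]
  | succ t hst ih =>
    rw [card_hits_Ico_succ z₀ hst, load_history_succ, ← Finset.insert_Ico_right_eq_Ico_add_one hst,
      Finset.filter_insert]
    by_cases h1 : f (history f z₀ z₁ t) (z₀ t) = true <;> by_cases h2 : z₀ t = m
    · rw [if_pos h1, if_pos h1, if_pos h2, Finset.filter_insert, if_pos h2,
        Finset.card_insert_of_notMem (by simp)]
      omega
    · rw [if_pos h1, if_pos h1, if_neg h2, Finset.filter_insert, if_neg h2]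
      omega
    · rw [if_neg h1, if_neg h1, if_pos h2]
      omega
    · rw [if_neg h1, if_neg h1, if_neg h2]
      omega

/-- All but at most as many bins as there are rejections in a period have at its end a load of at
least their number of primary allocations in it. -/
lemma card_bins_le {s t : ℕ} (hst : s ≤ t) (k : ℕ) :
    (Finset.univ.filter fun m => k ≤ (hits z₀ (Finset.Ico s t) m).card).card ≤
      (Finset.univ.filter fun m => k ≤ load (history f z₀ z₁ t) m).card +
        (rejections (history f z₀ z₁ t) - rejections (history f z₀ z₁ s)) := by
  set R := (Finset.Ico s t).filter fun i => f (history f z₀ z₁ i) (z₀ i) = true with hR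
  have hRc : R.card + rejections (history f z₀ z₁ s) = rejections (history f z₀ z₁ t) := by
    rw [rejections_history_eq_card, rejections_history_eq_card, hR,
      ← Finset.card_union_of_disjoint, ← Finset.filter_union]
    · congr 2
      ext i; simp only [Finset.mem_union, Finset.mem_Ico, Finset.mem_range]; omega
    · refine Finset.disjoint_filter_filter (Finset.disjoint_left.2 fun i hi hi' => ?_)
      simp only [Finset.mem_Ico, Finset.mem_range] at hi hi'
      omega
  have hRc' : R.card = rejections (history f z₀ z₁ t) - rejections (history f z₀ z₁ s) := by omega
  rw [← hRc']
  -- A bin can lose a primary allocation of the period only if it is the primary bin of some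
  -- rejected ball, hence lies in the image of R.
  refine (Finset.card_le_card (t := (Finset.univ.filter fun m => k ≤ load (history f z₀ z₁ t) m) ∪
    R.image z₀) fun m hm => ?_).trans ((Finset.card_union_le _ _).trans
      (Nat.add_le_add_left Finset.card_image_le _))
  simp only [Finset.mem_filter, Finset.mem_univ, true_and, Finset.mem_union, Finset.mem_image] at hm ⊢
  by_contra! hc
  have h1 := card_hits_le_load_add f z₀ z₁ hst m
  rw [← hR, Finset.filter_eq_empty_iff.2 (fun i hi => hc.2 i hi), Finset.card_empty] at h1
  omega

/-- The threshold strategy accepts at most `⌈ℓ⌉` balls into each bin. -/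
lemma load_thresholdStrategy_le (ℓ : ℝ) (t : ℕ) (m : Fin n) :
    load (history (thresholdStrategy n ℓ) z₀ z₁ t) m ≤
      min (primaryCount (history (thresholdStrategy n ℓ) z₀ z₁ t) m) ⌈ℓ⌉₊ +
      (hits z₁ (Finset.range (rejections (history (thresholdStrategy n ℓ) z₀ z₁ t))) m).card := by
  induction t with
  | zero => simp [history, load]
  | succ t ih =>
    have h3 : (if z₀ t = m then 1 else 0) = 1 ∨ (if z₀ t = m then 1 else 0) = 0 := by
      split_ifs <;> simp
    rw [load_history_succ, rejections_history_succ]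
    simp only [primaryCount_history, card_hits_range_succ] at ih ⊢
    by_cases h1 : thresholdStrategy n ℓ (history (thresholdStrategy n ℓ) z₀ z₁ t) (z₀ t) = true
    · rw [if_pos h1, if_pos h1, card_hits_range_succ]
      omega
    · rw [if_neg h1, if_neg h1, add_zero]
      by_cases h2 : z₀ t = m
      -- Acceptance means that the primary count is still below ⌈ℓ⌉, so the minimum grows together
      -- with the load. The bound ⌈ℓ⌉ alone would not be inductive.
      · have h4 : (hits z₀ (Finset.range t) m).card < ⌈ℓ⌉₊ := by
          simp only [thresholdStrategy, primaryCount_history, h2, decide_eq_true_eq, not_le] at h1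
          exact Nat.lt_ceil.2 h1
        rw [if_pos h2]
        omega
      · rw [if_neg h2]
        omega

/-- The history depends only on the secondary allocations that have been used. -/
lemma history_congr {f : Strategy n} {z₀ z₁ z₀' z₁' : ℕ → Fin n} {t : ℕ}
    (h₀ : ∀ i < t, z₀ i = z₀' i)
    (h₁ : ∀ i < rejections (history f z₀ z₁ t), z₁ i = z₁' i) :
    history f z₀' z₁' t = history f z₀ z₁ t := by
  induction t with
  | zero => rfl
  | succ t ih =>
    have h := ih (fun i hi => h₀ i (by omega)) fun i hi => h₁ i
      (hi.trans_le (rejections_history_mono f z₀ z₁ t.le_succ))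
    rw [history_succ, history_succ, h, ← h₀ t (by omega)]
    split_ifs with h2
    · rw [h₁]
      rw [rejections_history_succ, if_pos h2]
      omega
    · rfl

end History

/-! ### Independence of the unused secondary allocations from the history. -/

section Restart

variable {n : ℕ} {Ω : Type*} [MeasurableSpace Ω] {P : Measure Ω} {Z₀ Z₁ : ℕ → Ω → Fin n}

/-- The next `K` unused secondary allocations are independent of the history. -/
theorem IsUniformSource.measureReal_restart_le (hZ : IsUniformSource P Z₀ Z₁) (f : Strategy n)
    (T K : ℕ) (Φ : List (Record n) → (ℕ → Fin n) → Prop) {δ : ℝ}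
    (hΦ : ∀ h y y', (∀ i ∈ Finset.Ico (rejections h) (rejections h + K), y i = y' i) →
      (Φ h y → Φ h y'))
    (hδ : ∀ h, P.real {ω | Φ h fun i => Z₁ i ω} ≤ δ) :
    P.real {ω | Φ (history f (fun t => Z₀ t ω) (fun t => Z₁ t ω) T) fun i => Z₁ i ω} ≤ δ := by
  have := hZ.isProbabilityMeasure
  set hist : Ω → List (Record n) := fun ω => history f (fun t => Z₀ t ω) (fun t => Z₁ t ω) T
    with hhist
  have hmeas : ∀ i, Measurable (Sum.elim Z₀ Z₁ i) := by
    rintro (i | i)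
    · exact hZ.measurable₀ i
    · exact hZ.measurable₁ i
  have hfin : {l : List (Record n) | l.length = T}.Finite := List.finite_length_eq _ _
  set H : Finset (List (Record n)) := hfin.toFinset with hH
  have hmem : ∀ ω, hist ω ∈ H := fun ω => by simp [hH, hhist, length_history]
  -- By `history_congr`, whether the history equals h is decided by the first T primary entries and
  -- the first `rejections h` secondary ones.
  have hpre : ∀ h : List (Record n), ∃ A : Set (((Finset.range T).disjSum
      (Finset.range (rejections h)) : Finset (ℕ ⊕ ℕ)) → Fin n),
      {ω | hist ω = h} = (fun ω (i : ((Finset.range T).disjSum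
        (Finset.range (rejections h)) : Finset (ℕ ⊕ ℕ))) => Sum.elim Z₀ Z₁ i ω) ⁻¹' A := by
    intro h
    refine ⟨{x | ∃ z₀ z₁, (∀ i (hi : Sum.inl i ∈ (Finset.range T).disjSum
      (Finset.range (rejections h))), x ⟨Sum.inl i, hi⟩ = z₀ i) ∧ (∀ i (hi : Sum.inr i ∈
      (Finset.range T).disjSum (Finset.range (rejections h))), x ⟨Sum.inr i, hi⟩ = z₁ i) ∧
      history f z₀ z₁ T = h}, ?_⟩
    ext ω
    simp only [Set.mem_ofPred_eq, Set.mem_preimage]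
    constructor
    · intro hω
      exact ⟨fun t => Z₀ t ω, fun t => Z₁ t ω, fun _ _ => rfl, fun _ _ => rfl, hω⟩
    · rintro ⟨z₀, z₁, h0, h1, h2⟩
      rw [← h2]
      refine history_congr (fun i hi => ?_) (fun i hi => ?_)
      · exact (h0 i (by simpa using hi)).symm
      · rw [h2] at hi
        exact (h1 i (by simpa using hi)).symm
  have hpre2 : ∀ h : List (Record n), ∃ A : Set (((∅ : Finset ℕ).disjSum
      (Finset.Ico (rejections h) (rejections h + K)) : Finset (ℕ ⊕ ℕ)) → Fin n),
      {ω | Φ h fun i => Z₁ i ω} = (fun ω (i : ((∅ : Finset ℕ).disjSum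
        (Finset.Ico (rejections h) (rejections h + K)) : Finset (ℕ ⊕ ℕ))) => Sum.elim Z₀ Z₁ i ω) ⁻¹' A := by
    intro h
    refine ⟨{x | ∃ z₁, (∀ i (hi : Sum.inr i ∈
      (∅ : Finset ℕ).disjSum (Finset.Ico (rejections h) (rejections h + K))),
        x ⟨Sum.inr i, hi⟩ = z₁ i) ∧ Φ h z₁}, ?_⟩
    ext ω
    simp only [Set.mem_ofPred_eq, Set.mem_preimage]
    constructor
    · intro hω
      exact ⟨fun t => Z₁ t ω, fun _ _ => rfl, hω⟩
    · rintro ⟨z₁, h1, h2⟩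
      refine hΦ h _ _ (fun i hi => ?_) h2
      exact (h1 i (by simpa using hi)).symm
  have hHmeas : ∀ h, MeasurableSet {ω | hist ω = h} := fun h => by
    obtain ⟨A, hA⟩ := hpre h
    rw [hA]
    exact (Set.toFinite A).measurableSet.preimage (measurable_pi_lambda _ fun i => hmeas i)
  have hind : ∀ h, P.real ({ω | hist ω = h} ∩ {ω | Φ h fun i => Z₁ i ω}) ≤
      P.real {ω | hist ω = h} * δ := fun h => by
    refine le_trans (le_of_eq ?_) (mul_le_mul_of_nonneg_left (hδ h) measureReal_nonneg)
    obtain ⟨A, hA⟩ := hpre h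
    obtain ⟨A', hA'⟩ := hpre2 h
    -- For fixed h the secondary entries read by `Φ` start exactly where those determining h end.
    -- The two coordinate blocks are disjoint, and summing over the finitely many h gives the claim.
    have hi := hZ.indep.indepFun_finset ((Finset.range T).disjSum (Finset.range (rejections h)))
      ((∅ : Finset ℕ).disjSum (Finset.Ico (rejections h) (rejections h + K))) (by
        refine Finset.disjoint_left.2 ?_
        rintro (i | i) hi hi'
        · simp at hi'
        · simp only [Finset.inr_mem_disjSum, Finset.mem_range, Finset.mem_Ico] at hi hi'
          omega) hmeas
    rw [hA, hA', measureReal_def, measureReal_def, measureReal_def,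
      hi.measure_inter_preimage_eq_mul _ _ (Set.toFinite A).measurableSet
        (Set.toFinite A').measurableSet, ENNReal.toReal_mul]
  have hsum : ∑ h ∈ H, P.real {ω | hist ω = h} = 1 := by
    rw [← measureReal_biUnion_finset]
    · rw [show (⋃ h ∈ H, {ω | hist ω = h}) = Set.univ by
        ext ω; simpa using hmem ω, probReal_univ]
    · intro a _ b _ hab
      refine Set.disjoint_left.2 fun ω h1 h2 => hab ?_
      exact h1.symm.trans h2
    · exact fun h _ => hHmeas h
  calc P.real {ω | Φ (hist ω) fun i => Z₁ i ω}
      ≤ P.real (⋃ h ∈ H, ({ω | hist ω = h} ∩ {ω | Φ h fun i => Z₁ i ω})) := by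
        refine measureReal_mono (fun ω hω => ?_) (measure_ne_top _ _)
        simp only [Set.mem_iUnion]
        exact ⟨hist ω, hmem ω, rfl, hω⟩
    _ ≤ ∑ h ∈ H, P.real ({ω | hist ω = h} ∩ {ω | Φ h fun i => Z₁ i ω}) :=
        measureReal_biUnion_finset_le _ _
    _ ≤ ∑ h ∈ H, P.real {ω | hist ω = h} * δ := Finset.sum_le_sum fun h _ => hind h
    _ = δ := by rw [← Finset.sum_mul, hsum, one_mul]

end Restart

/-! ### Asymptotics of the threshold and the decay rate. -/

section Asymptotics

/-- The threshold `√(2 log n / log log n)`. -/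
noncomputable def threshold (n : ℕ) : ℝ := √(2 * Real.log n / Real.log (Real.log n))

/-- The threshold strategy rejects a proportion of about `exp (-decayRate n)` of the balls. -/
noncomputable def decayRate (n : ℕ) : ℝ := Real.log n / threshold n

lemma threshold_nonneg (n : ℕ) : 0 ≤ threshold n := Real.sqrt_nonneg _

lemma tendsto_log_natCast : Tendsto (fun n : ℕ => Real.log n) atTop atTop :=
  Real.tendsto_log_atTop.comp tendsto_natCast_atTop_atTop

lemma tendsto_log_log_natCast : Tendsto (fun n : ℕ => Real.log (Real.log n)) atTop atTop :=
  Real.tendsto_log_atTop.comp tendsto_log_natCast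

lemma tendsto_log_div_self : Tendsto (fun x : ℝ => Real.log x / x) atTop (𝓝 0) :=
  Real.isLittleO_log_id_atTop.tendsto_div_nhds_zero

lemma sqrt_eight_mul_log_div (n : ℕ) :
    √(8 * Real.log n / Real.log (Real.log n)) = 2 * threshold n := by
  rw [threshold, show 8 * Real.log n / Real.log (Real.log n) =
    2 ^ 2 * (2 * Real.log n / Real.log (Real.log n)) by ring,
    Real.sqrt_mul (by norm_num), Real.sqrt_sq (by norm_num)]

lemma tendsto_threshold : Tendsto threshold atTop atTop := by
  refine Real.tendsto_sqrt_atTop.comp ?_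
  have h1 : Tendsto (fun x : ℝ => (Real.log x / x)⁻¹) atTop atTop := by
    refine Tendsto.inv_tendsto_nhdsGT_zero (tendsto_nhdsWithin_iff.2 ⟨tendsto_log_div_self, ?_⟩)
    filter_upwards [eventually_gt_atTop 1] with x hx
    exact div_pos (Real.log_pos hx) (by linarith)
  refine ((h1.comp tendsto_log_natCast).const_mul_atTop two_pos).congr fun n => ?_
  simp only [Function.comp, inv_div]
  ring

lemma eventually_threshold_mul_decayRate :
    ∀ᶠ n : ℕ in atTop, threshold n * decayRate n = Real.log n := by
  filter_upwards [tendsto_threshold.eventually_gt_atTop 0] with n hn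
  rw [decayRate]
  field_simp

/-- This is what singles out the threshold: log L is asymptotic to (log log n) / 2, so L² log L is
asymptotic to log n = L A. Factorials of multiples of L thus become powers of exp A. -/
lemma tendsto_threshold_mul_log_div :
    Tendsto (fun n => threshold n * Real.log (threshold n) / decayRate n) atTop (𝓝 1) := by
  have h1 : Tendsto (fun x : ℝ => Real.log 2 / x + 1 - Real.log x / x) atTop (𝓝 (0 + 1 - 0)) :=
    ((tendsto_const_nhds.div_atTop tendsto_id).add tendsto_const_nhds).sub tendsto_log_div_self
  rw [zero_add, sub_zero] at h1
  refine (h1.comp tendsto_log_log_natCast).congr' ?_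
  filter_upwards [tendsto_log_natCast.eventually_gt_atTop 0,
    tendsto_log_log_natCast.eventually_gt_atTop 0] with n h2 h3
  simp only [Function.comp]
  have h4 : 0 < 2 * Real.log n / Real.log (Real.log n) := by positivity
  have h5 : threshold n ^ 2 = 2 * Real.log n / Real.log (Real.log n) := Real.sq_sqrt h4.le
  have h6 : 0 < threshold n := Real.sqrt_pos.2 h4
  have h7 : Real.log (threshold n) = (Real.log 2 + Real.log (Real.log n) -
      Real.log (Real.log (Real.log n))) / 2 := by
    rw [threshold, Real.log_sqrt h4.le, Real.log_div (by positivity) h3.ne',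
      Real.log_mul two_ne_zero h2.ne']
  have h8 : threshold n * Real.log (threshold n) / decayRate n =
      threshold n ^ 2 * Real.log (threshold n) / Real.log n := by
    rw [decayRate]; field_simp
  rw [h8, h5, h7]
  field_simp

lemma tendsto_log_threshold : Tendsto (fun n => Real.log (threshold n)) atTop atTop :=
  Real.tendsto_log_atTop.comp tendsto_threshold

/-- Makes factors of the form c ^ L negligible against exp (τ A). -/
lemma tendsto_threshold_div_decayRate :
    Tendsto (fun n => threshold n / decayRate n) atTop (𝓝 0) := by
  refine (tendsto_threshold_mul_log_div.div_atTop tendsto_log_threshold).congr' ?_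
  filter_upwards [tendsto_log_threshold.eventually_gt_atTop 0] with n hn
  field_simp

lemma eventually_decayRate_pos : ∀ᶠ n in atTop, 0 < decayRate n := by
  filter_upwards [tendsto_log_natCast.eventually_gt_atTop 0,
    tendsto_threshold.eventually_gt_atTop 0] with n h1 h2
  exact div_pos h1 h2

lemma eventually_threshold_le_decayRate : ∀ᶠ n in atTop, threshold n ≤ decayRate n := by
  filter_upwards [tendsto_threshold_div_decayRate.eventually_le_const one_pos,
    eventually_decayRate_pos] with n h1 h2
  rwa [div_le_one h2] at h1

lemma tendsto_decayRate : Tendsto decayRate atTop atTop :=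
  tendsto_atTop_mono' _ eventually_threshold_le_decayRate tendsto_threshold

lemma tendsto_threshold_div_natCast : Tendsto (fun n : ℕ => threshold n / n) atTop (𝓝 0) := by
  refine tendsto_of_tendsto_of_tendsto_of_le_of_le' tendsto_const_nhds
    (tendsto_inv_atTop_zero.comp tendsto_threshold) ?_ ?_
  · exact Eventually.of_forall fun n => div_nonneg (Real.sqrt_nonneg _) n.cast_nonneg
  · filter_upwards [tendsto_threshold.eventually_gt_atTop 0, eventually_threshold_mul_decayRate,
      eventually_threshold_le_decayRate, eventually_gt_atTop 0] with n h1 h2 h3 h4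
    have h5 : (0 : ℝ) < n := by exact_mod_cast h4
    have h6 := Real.log_le_sub_one_of_pos h5
    simp only [Function.comp]
    rw [div_le_iff₀ h5, ← div_eq_inv_mul, le_div_iff₀ h1]
    nlinarith

lemma eventually_mul_threshold_le (b : ℝ) {c : ℝ} (hc : 0 < c) :
    ∀ᶠ n : ℕ in atTop, b * threshold n ≤ c * n := by
  have h := tendsto_threshold_div_natCast.const_mul b
  rw [mul_zero] at h
  filter_upwards [h.eventually_le_const hc, eventually_gt_atTop 0] with n h1 h2
  have h5 : (0 : ℝ) < n := by exact_mod_cast h2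
  rwa [← mul_div_assoc, div_le_iff₀ h5] at h1

lemma tendsto_floor_mul_threshold_div {b : ℝ} (hb : 0 ≤ b) :
    Tendsto (fun n : ℕ => 16 * (⌊b * threshold n⌋₊ : ℝ) / n) atTop (𝓝 0) := by
  have h := tendsto_threshold_div_natCast.const_mul (16 * b)
  rw [mul_zero] at h
  refine squeeze_zero (fun n => by positivity) (fun n => ?_) h
  rw [mul_assoc, ← mul_div_assoc, ← mul_div_assoc]
  have := Nat.floor_le (mul_nonneg hb (threshold_nonneg n))
  gcongr

lemma eventually_eq_exp_threshold_mul_decayRate :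
    ∀ᶠ n : ℕ in atTop, (n : ℝ) = Real.exp (threshold n * decayRate n) := by
  filter_upwards [eventually_threshold_mul_decayRate, eventually_gt_atTop 0] with n h1 h2
  rw [h1, Real.exp_log (by exact_mod_cast h2)]

lemma tendsto_natCast_mul_exp (a : ℝ) :
    Tendsto (fun n : ℕ => n * Real.exp (-(a * decayRate n))) atTop atTop := by
  have h : Tendsto (fun n => (threshold n - a) * decayRate n) atTop atTop :=
    (tendsto_atTop_add_const_right _ (-a) tendsto_threshold).atTop_mul_atTop₀ tendsto_decayRate
  refine (Real.tendsto_exp_atTop.comp h).congr' ?_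
  filter_upwards [eventually_eq_exp_threshold_mul_decayRate] with n h1
  simp only [Function.comp]
  rw [h1, ← Real.exp_add]
  congr 1; ring

/-- The factorial-type term `(κ / j) ^ j` for `j = b L` decays like `exp (-b A)`. -/
lemma eventually_exp_le_div_floor_pow {κ b τ : ℝ} (hκ : 0 < κ) (hb : 0 ≤ b) (hτ : 0 < τ) :
    ∀ᶠ n in atTop, Real.exp (-((b + τ) * decayRate n)) ≤
      (κ / ⌊b * threshold n⌋₊ : ℝ) ^ ⌊b * threshold n⌋₊ := by
  have hlim : Tendsto (fun n => b * (threshold n * Real.log (threshold n) / decayRate n) +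
      b * (Real.log b - Real.log κ) * (threshold n / decayRate n)) atTop (𝓝 (b * 1 +
        b * (Real.log b - Real.log κ) * 0)) :=
    (tendsto_threshold_mul_log_div.const_mul b).add
      (tendsto_threshold_div_decayRate.const_mul _)
  have hlt : b * 1 + b * (Real.log b - Real.log κ) * 0 < b + τ := by linarith
  have hbig : ∀ᶠ n in atTop, b ≠ 0 → κ ≤ b * threshold n := by
    by_cases h0 : b = 0
    · simp [h0]
    · filter_upwards [(tendsto_threshold.const_mul_atTop
        (lt_of_le_of_ne hb (Ne.symm h0))).eventually_ge_atTop κ] with n hn _ using hn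
  filter_upwards [hlim.eventually_lt_const hlt, eventually_decayRate_pos, hbig,
    tendsto_threshold.eventually_gt_atTop 0] with n h1 h2 h3 h4
  set j := ⌊b * threshold n⌋₊ with hj
  rcases Nat.eq_zero_or_pos j with h0 | h0
  · rw [h0, pow_zero]
    refine Real.exp_le_one_iff.2 ?_
    have : 0 ≤ (b + τ) * decayRate n := by positivity
    linarith
  · have hb0 : b ≠ 0 := by
      rintro rfl
      simp [hj] at h0
    have hbp : 0 < b := lt_of_le_of_ne hb (Ne.symm hb0)
    have hκb := h3 hb0
    have hbL : 0 < b * threshold n := by positivity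
    have hjle : (j : ℝ) ≤ b * threshold n := Nat.floor_le hbL.le
    have hj0 : (0 : ℝ) < j := by exact_mod_cast h0
    have e1 : (κ / (b * threshold n)) ^ j ≤ (κ / j : ℝ) ^ j := by gcongr
    -- The base is at most 1, so replacing the integer exponent j by the larger real b L only
    -- decreases the power.
    have e2 : (κ / (b * threshold n)) ^ (b * threshold n) ≤ (κ / (b * threshold n)) ^ j := by
      rw [← Real.rpow_natCast]
      exact Real.rpow_le_rpow_of_exponent_ge (by positivity) ((div_le_one hbL).2 hκb) hjle
    refine le_trans ?_ (e2.trans e1)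
    rw [Real.rpow_def_of_pos (by positivity), Real.log_div hκ.ne' hbL.ne',
      Real.log_mul hb0 h4.ne']
    refine Real.exp_le_exp.2 ?_
    have h5 := mul_lt_mul_of_pos_right h1 h2
    have h6 : (b * (threshold n * Real.log (threshold n) / decayRate n) +
      b * (Real.log b - Real.log κ) * (threshold n / decayRate n)) * decayRate n =
      b * (threshold n * Real.log (threshold n)) +
      b * (Real.log b - Real.log κ) * threshold n := by
      field_simp
    rw [h6] at h5
    linarith

/-- Supplies the hypotheses of `measureReal_few_bins_le` for the primary balls of one period of
length q. Lowering the load by the factor 1 - η gains exp (η a A): half pays for the error in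
`eventually_exp_le_div_floor_pow`, half for the constants 4 and exp (-2ρ). -/
lemma eventually_primary_bins {ρ κ a η : ℝ} (hκ : 0 < κ) (ha : 0 < a) (hη : 0 < η) (hη1 : η ≤ 1)
    {q : ℕ → ℕ} (hq : ∀ᶠ n : ℕ in atTop, κ * n ≤ q n) (hqρ : ∀ n : ℕ, (q n : ℝ) ≤ ρ * n) :
    ∀ᶠ n : ℕ in atTop, ⌊(1 - η) * a * threshold n⌋₊ ≤ q n ∧
      4 * ⌊(1 - η) * a * threshold n⌋₊ ≤ n ∧
      2 * (2 * (n * Real.exp (-(a * decayRate n)))) ≤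
        n * ((q n / (⌊(1 - η) * a * threshold n⌋₊ * n) : ℝ) ^ ⌊(1 - η) * a * threshold n⌋₊ *
          Real.exp (-(2 * q n / n))) := by
  have hη' : 0 ≤ 1 - η := by linarith
  have hb : 0 ≤ (1 - η) * a := by positivity
  have hbig := (tendsto_decayRate.const_mul_atTop
    (show 0 < η * a / 2 by positivity)).eventually_ge_atTop (Real.log 4 + 2 * ρ)
  filter_upwards [hq, eventually_mul_threshold_le ((1 - η) * a) hκ,
    eventually_mul_threshold_le ((1 - η) * a) (show (0 : ℝ) < 1 / 4 by norm_num),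
    eventually_exp_le_div_floor_pow hκ hb (show 0 < η * a / 2 by positivity), hbig,
    eventually_gt_atTop 0] with n h1 h2 h3 h4 h5 h6
  have hfl := Nat.floor_le (mul_nonneg hb (threshold_nonneg n))
  have hn0 : (0 : ℝ) < n := by exact_mod_cast h6
  set k := ⌊(1 - η) * a * threshold n⌋₊
  refine ⟨?_, ?_, ?_⟩
  · exact_mod_cast (hfl.trans h2).trans h1
  · have : (4 * k : ℝ) ≤ n := by linarith
    exact_mod_cast this
  · have e1 : (κ / k : ℝ) ^ k ≤ (q n / (k * n) : ℝ) ^ k := by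
      refine pow_le_pow_left₀ (by positivity) ?_ _
      rw [mul_comm, ← div_div]
      have : κ ≤ q n / n := by rwa [le_div_iff₀ hn0]
      gcongr
    have e2 : Real.exp (-(2 * ρ)) ≤ Real.exp (-(2 * q n / n)) := by
      refine Real.exp_le_exp.2 (neg_le_neg ?_)
      rw [mul_div_assoc]
      have : q n / n ≤ ρ := by rw [div_le_iff₀ hn0]; exact hqρ n
      linarith
    calc 2 * (2 * (n * Real.exp (-(a * decayRate n))))
        = n * (Real.exp (Real.log 4) * Real.exp (-(a * decayRate n))) := by
          rw [Real.exp_log (by norm_num)]; ring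
      _ ≤ n * (Real.exp (-(((1 - η) * a + η * a / 2) * decayRate n)) * Real.exp (-(2 * ρ))) := by
          rw [← Real.exp_add, ← Real.exp_add]
          refine mul_le_mul_of_nonneg_left (Real.exp_le_exp.2 ?_) hn0.le
          linarith
      _ ≤ _ := by
          have h7 := h4.trans e1
          gcongr

/-- Supplies the hypotheses of `measureReal_few_bins_le` for n exp (-a A) bins and n exp (-a' A)
secondary balls. The expected number of bins with (1-η) L / a' hits is at least exp (η L A - O(A)).
The target L is merely a convenient quantity tending to infinity. -/
lemma eventually_secondary_bins {a a' η : ℝ} (ha' : 0 < a') (hη : 0 < η) (hη1 : η ≤ 1) :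
    ∀ᶠ n : ℕ in atTop, ⌊(1 - η) / a' * threshold n⌋₊ ≤ ⌈n * Real.exp (-(a' * decayRate n))⌉₊ ∧
      4 * ⌊(1 - η) / a' * threshold n⌋₊ ≤ n ∧
      2 * threshold n ≤ (n * Real.exp (-(a * decayRate n))) *
        ((⌈n * Real.exp (-(a' * decayRate n))⌉₊ / (⌊(1 - η) / a' * threshold n⌋₊ * n) : ℝ) ^
          ⌊(1 - η) / a' * threshold n⌋₊ *
          Real.exp (-(2 * ⌈n * Real.exp (-(a' * decayRate n))⌉₊ / n))) := by
  have hη' : 0 ≤ 1 - η := by linarith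
  set b := (1 - η) / a' with hbdef
  have hb : 0 ≤ b := by positivity
  have hba : b * a' = 1 - η := by rw [hbdef]; field_simp
  filter_upwards [eventually_mul_threshold_le b (show (0 : ℝ) < 1 / 4 by norm_num),
    eventually_exp_le_div_floor_pow one_pos hb one_pos,
    tendsto_decayRate.eventually_ge_atTop 1, eventually_threshold_le_decayRate,
    tendsto_threshold.eventually_ge_atTop (a' + b),
    -- The terms a and b + 1 absorb the losses of order A; the 6 leaves 6 A ≥ 2 L + 4, because A ≥ L
    -- and A ≥ 1.
    (tendsto_threshold.const_mul_atTop hη).eventually_ge_atTop (6 + a + (b + 1)),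
    eventually_eq_exp_threshold_mul_decayRate, eventually_gt_atTop 0,
    tendsto_threshold.eventually_gt_atTop 0] with n h1 h2 h3 h4 h5 h6 h7 h8 h9
  have hfl := Nat.floor_le (mul_nonneg hb h9.le)
  have hn0 : (0 : ℝ) < n := by exact_mod_cast h8
  have hn1 : (1 : ℝ) ≤ n := by exact_mod_cast h8
  set j := ⌊b * threshold n⌋₊
  set x : ℝ := n * Real.exp (-(a' * decayRate n)) with hx
  have hx0 : 0 < x := by positivity
  have hxn : x ≤ n := by
    rw [hx]
    refine mul_le_of_le_one_right hn0.le (Real.exp_le_one_iff.2 ?_)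
    have : 0 < a' * decayRate n := by positivity
    linarith
  have hK1 : x ≤ ⌈x⌉₊ := Nat.le_ceil x
  have hK2 : (⌈x⌉₊ : ℝ) < x + 1 := Nat.ceil_lt_add_one hx0.le
  refine ⟨?_, ?_, ?_⟩
  · have e1 : b * threshold n ≤ x := by
      rw [hx, h7, ← Real.exp_add]
      refine le_trans ?_ (Real.add_one_le_exp _)
      nlinarith
    exact_mod_cast (hfl.trans e1).trans hK1
  · have : (4 * j : ℝ) ≤ n := by linarith
    exact_mod_cast this
  · have e0 : Real.exp (-(a' * decayRate n)) ≤ ⌈x⌉₊ / n := by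
      rw [le_div_iff₀ hn0, mul_comm]; exact hK1
    have e1 : Real.exp (-((1 - η) * (threshold n * decayRate n))) ≤ (⌈x⌉₊ / n : ℝ) ^ j := by
      refine le_trans ?_ (pow_le_pow_left₀ (Real.exp_pos _).le e0 j)
      rw [← Real.exp_nat_mul]
      refine Real.exp_le_exp.2 ?_
      have : (j : ℝ) * (a' * decayRate n) ≤ b * threshold n * (a' * decayRate n) := by gcongr
      have e : b * threshold n * (a' * decayRate n) =
          (1 - η) * (threshold n * decayRate n) := by rw [← hba]; ring
      linarith
    have e2 : (⌈x⌉₊ / (j * n) : ℝ) ^ j = (⌈x⌉₊ / n : ℝ) ^ j * (1 / j) ^ j := by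
      rw [← mul_pow]; congr 1; field_simp
    -- The ceiling is at most x + 1 ≤ 2n.
    have e3 : Real.exp (-4) ≤ Real.exp (-(2 * ⌈x⌉₊ / n)) := by
      refine Real.exp_le_exp.2 (neg_le_neg ?_)
      rw [div_le_iff₀ hn0]
      linarith
    calc 2 * threshold n ≤ Real.exp (2 * threshold n) := by
          linarith [Real.add_one_le_exp (2 * threshold n)]
      _ ≤ Real.exp (threshold n * decayRate n + -(a * decayRate n) +
            (-((1 - η) * (threshold n * decayRate n)) + -((b + 1) * decayRate n) + -4)) := by
          refine Real.exp_le_exp.2 ?_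
          nlinarith
      _ = (n * Real.exp (-(a * decayRate n))) *
          (Real.exp (-((1 - η) * (threshold n * decayRate n))) *
            Real.exp (-((b + 1) * decayRate n)) * Real.exp (-4)) := by
          rw [Real.exp_add, Real.exp_add, Real.exp_add, Real.exp_add, ← h7]
      _ ≤ _ := by
          rw [e2]
          gcongr

/-- This is Markov's bound for at least n exp (-(1-τ) A) rejections. It vanishes because ρ^k / k! ≤
(eρ/k)^k is at most exp (-(1 - o(1)) A) at k = ⌈L⌉. -/
lemma tendsto_rejections_bound {ρ τ : ℝ} (hρ : 0 < ρ) (hτ : 0 < τ) :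
    Tendsto (fun n : ℕ => ρ * (ρ ^ ⌈threshold n⌉₊ / (⌈threshold n⌉₊).factorial) *
      Real.exp ((1 - τ) * decayRate n)) atTop (𝓝 0) := by
  set c : ℝ := Real.exp 1 * ρ with hc
  have hc0 : 0 < c := by positivity
  have hlim : Tendsto (fun n => (1 - τ) -
      threshold n * Real.log (threshold n) / decayRate n +
      Real.log c * (threshold n / decayRate n)) atTop (𝓝 ((1 - τ) - 1 + Real.log c * 0)) :=
    (tendsto_threshold_mul_log_div.const_sub _).add (tendsto_threshold_div_decayRate.const_mul _)
  have hneg : (1 - τ) - 1 + Real.log c * 0 < 0 := by linarith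
  have hbot := (hlim.neg_mul_atTop hneg tendsto_decayRate)
  have h0 := (Real.tendsto_exp_atBot.comp hbot).const_mul ρ
  rw [mul_zero] at h0
  refine squeeze_zero' (Eventually.of_forall fun n => by positivity) ?_ h0
  filter_upwards [tendsto_threshold.eventually_ge_atTop c, eventually_decayRate_pos,
    tendsto_threshold.eventually_gt_atTop 0] with n h1 h2 h3
  set k := ⌈threshold n⌉₊ with hk
  have hLk : threshold n ≤ k := Nat.le_ceil _
  have hk0 : (0 : ℝ) < k := h3.trans_le hLk
  have e1 : ρ ^ k / (k.factorial : ℝ) ≤ (c / threshold n) ^ (threshold n) := by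
    have h4 : (k : ℝ) ^ k / k.factorial ≤ Real.exp k := Real.pow_div_factorial_le_exp _ hk0.le k
    calc ρ ^ k / (k.factorial : ℝ) = (ρ / k) ^ k * ((k : ℝ) ^ k / k.factorial) := by
          rw [div_pow]; field_simp
      _ ≤ (ρ / k) ^ k * Real.exp k := by gcongr
      _ = (c / k) ^ k := by
          rw [← Real.exp_one_pow k, ← mul_pow, hc]; congr 1; ring
      _ ≤ (c / threshold n) ^ k := by gcongr
      _ ≤ _ := by
          rw [← Real.rpow_natCast]
          exact Real.rpow_le_rpow_of_exponent_ge (by positivity) ((div_le_one h3).2 h1) hLk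
  have e2 : (c / threshold n) ^ (threshold n) =
      Real.exp (threshold n * Real.log c - threshold n * Real.log (threshold n)) := by
    rw [Real.rpow_def_of_pos (by positivity), Real.log_div hc0.ne' h3.ne']
    congr 1; ring
  rw [mul_assoc]
  refine mul_le_mul_of_nonneg_left ?_ hρ.le
  refine (mul_le_mul_of_nonneg_right (e1.trans e2.le) (Real.exp_pos _).le).trans (le_of_eq ?_)
  rw [← Real.exp_add]
  simp only [Function.comp]
  congr 1
  field_simp
  ring

lemma tendsto_secondary_bound {c : ℝ} (hc : 1 < c) :
    Tendsto (fun n : ℕ => Real.exp (threshold n * decayRate n - c * (threshold n * decayRate n)))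
      atTop (𝓝 0) := by
  have h := (tendsto_threshold.atTop_mul_atTop₀ tendsto_decayRate).const_mul_atTop_of_neg
    (show 1 - c < 0 by linarith)
  refine (Real.tendsto_exp_atBot.comp h).congr fun n => ?_
  simp only [Function.comp]
  congr 1; ring

end Asymptotics

/-! ### Upper bound for the threshold strategy. -/

section Bounds

variable {ρ : ℝ} {Ω : ℕ → Type*} [∀ n, MeasurableSpace (Ω n)] {P : ∀ n, Measure (Ω n)}
  {Z₀ Z₁ : ∀ n, ℕ → Ω n → Fin n}

lemma eventually_isProbabilityMeasure
    (hZ : ∀ n, 1 ≤ n → IsUniformSource (P n) (Z₀ n) (Z₁ n)) :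
    ∀ᶠ n in atTop, IsProbabilityMeasure (P n) := by
  filter_upwards [eventually_ge_atTop 1] with n hn using (hZ n hn).isProbabilityMeasure

/-- Markov's inequality for the number of rejections of a threshold strategy. -/
lemma measureReal_rejections_thresholdStrategy_le {n : ℕ} (hn : 1 ≤ n) {Ω : Type*}
    [MeasurableSpace Ω] {P : Measure Ω} {Z₀ Z₁ : ℕ → Ω → Fin n} (hZ : IsUniformSource P Z₀ Z₁)
    (ℓ : ℝ) (hρ : 0 < ρ) {x : ℝ} (hx : 0 < x) :
    P.real {ω | x ≤ (rejections (history (thresholdStrategy n ℓ) (fun t => Z₀ t ω)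
      (fun t => Z₁ t ω) ⌊ρ * n⌋₊) : ℝ)} ≤
        ρ * n * (ρ ^ ⌈ℓ⌉₊ / (⌈ℓ⌉₊).factorial) / x := by
  classical
  have := hZ.isProbabilityMeasure
  have hn0 : (0 : ℝ) < n := by positivity
  have hN : (⌊ρ * n⌋₊ : ℝ) ≤ ρ * n := Nat.floor_le (by positivity)
  have hmeas : ∀ t, MeasurableSet {ω | ⌈ℓ⌉₊ ≤ (hits (fun i => Z₀ i ω) (Finset.range t)
      (Z₀ t ω)).card} := fun t => by
    have h : {ω | ⌈ℓ⌉₊ ≤ (hits (fun i => Z₀ i ω) (Finset.range t) (Z₀ t ω)).card} =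
        ⋃ m : Fin n, ({ω | Z₀ t ω = m} ∩ ⋃ j ∈ Set.Ici ⌈ℓ⌉₊,
          {ω | (hits (fun i => Z₀ i ω) (Finset.range t) m).card = j}) := by
      ext ω; simp
    rw [h]
    exact MeasurableSet.iUnion fun m => (hZ.measurable₀ t (measurableSet_singleton m)).inter
      (MeasurableSet.biUnion (Set.to_countable _) fun j _ =>
        hZ.primary.measurableSet_card_hits _ _ _)
  have key := measureReal_le_card_filter (P := P) (Finset.range ⌊ρ * n⌋₊)
    (fun t => {ω | ⌈ℓ⌉₊ ≤ (hits (fun i => Z₀ i ω) (Finset.range t) (Z₀ t ω)).card})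
    (fun t _ => hmeas t) (ρ ^ ⌈ℓ⌉₊ / (⌈ℓ⌉₊).factorial) (fun t ht => by
      refine (hZ.primary.measureReal_repeated_primary_le hn t _).trans ?_
      have ht' : (t : ℝ) ≤ ρ * n :=
        le_trans (by exact_mod_cast (Finset.mem_range.1 ht).le) hN
      have h1 : (t.choose ⌈ℓ⌉₊ : ℝ) ≤ (t : ℝ) ^ ⌈ℓ⌉₊ / (⌈ℓ⌉₊).factorial :=
        Nat.choose_le_pow_div _ _
      calc (t.choose ⌈ℓ⌉₊ : ℝ) * (1 / n) ^ ⌈ℓ⌉₊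
          ≤ (ρ * n) ^ ⌈ℓ⌉₊ / (⌈ℓ⌉₊).factorial * (1 / n) ^ ⌈ℓ⌉₊ := by
            refine mul_le_mul_of_nonneg_right (h1.trans ?_) (by positivity)
            gcongr
        _ = (ρ * n * (1 / n)) ^ ⌈ℓ⌉₊ / (⌈ℓ⌉₊).factorial := by
            rw [mul_pow _ (1 / n : ℝ)]; ring
        _ = _ := by
            congr 2; field_simp) hx
  -- Rejections of a threshold strategy depend on the primary sequence alone.
  have hset : {ω | x ≤ (rejections (history (thresholdStrategy n ℓ) (fun t => Z₀ t ω)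
      (fun t => Z₁ t ω) ⌊ρ * n⌋₊) : ℝ)} = {ω | x ≤ (((Finset.range ⌊ρ * n⌋₊).filter fun t =>
        ω ∈ {ω | ⌈ℓ⌉₊ ≤ (hits (fun i => Z₀ i ω) (Finset.range t) (Z₀ t ω)).card}).card : ℝ)} := by
    ext ω
    simp only [Set.mem_ofPred_eq]
    rw [rejections_history_eq_card]
    simp only [thresholdStrategy, primaryCount_history, decide_eq_true_eq, Nat.ceil_le]
  rw [hset]
  refine key.trans ?_
  rw [Finset.card_range]
  gcongr

theorem tendsto_measureReal_maxLoad_thresholdStrategy_gt (hρ : 0 < ρ)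
    (hZ : ∀ n, 1 ≤ n → IsUniformSource (P n) (Z₀ n) (Z₁ n)) {ε : ℝ} (hε : 0 < ε) :
    Tendsto (fun n => (P n).real {ω | (1 + ε) * (2 * threshold n) <
      (randomMaxLoad (Z₀ n) (Z₁ n) ρ (thresholdStrategy n (threshold n)) ω : ℝ)}) atTop (𝓝 0) := by
  -- Chosen so that (1-τ)(1+ε) = 1 + ε/2 exceeds 1, as the union bound over secondary hits requires.
  set τ : ℝ := ε / (2 * (1 + ε)) with hτ
  have hτ0 : 0 < τ := by positivity
  have hτε : (1 - τ) * (1 + ε) = 1 + ε / 2 := by rw [hτ]; field_simp; ring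
  have hτ1 : 0 < 1 - τ := by
    by_contra! h
    nlinarith
  refine squeeze_zero' (g := fun n => ρ * (ρ ^ ⌈threshold n⌉₊ / (⌈threshold n⌉₊).factorial) *
      Real.exp ((1 - τ) * decayRate n) + Real.exp (threshold n * decayRate n -
        ((1 - τ) * (1 + ε)) * (threshold n * decayRate n)))
    (Eventually.of_forall fun n => measureReal_nonneg) ?_ ?_
  swap
  · have h := (tendsto_rejections_bound hρ hτ0).add
      (tendsto_secondary_bound (c := (1 - τ) * (1 + ε)) (by linarith))
    rwa [zero_add] at h
  filter_upwards [eventually_ge_atTop 1, eventually_eq_exp_threshold_mul_decayRate,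
    -- ε L ≥ 2 pays for the two ceilings in the load bound ⌈L⌉ + ⌈(1+ε) L⌉.
    eventually_decayRate_pos, (tendsto_threshold.const_mul_atTop hε).eventually_ge_atTop 2]
    with n hn h1 h2 h3
  have hZn := hZ n hn
  have := hZn.isProbabilityMeasure
  have hn0 : (0 : ℝ) < n := by positivity
  set x : ℝ := n * Real.exp (-((1 - τ) * decayRate n)) with hx
  have hx0 : 0 < x := by positivity
  set j := ⌈(1 + ε) * threshold n⌉₊ with hj
  have hL := threshold_nonneg n
  have hsub : {ω | (1 + ε) * (2 * threshold n) <
      (randomMaxLoad (Z₀ n) (Z₁ n) ρ (thresholdStrategy n (threshold n)) ω : ℝ)} ⊆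
      {ω | x ≤ (rejections (history (thresholdStrategy n (threshold n)) (fun t => Z₀ n t ω)
      (fun t => Z₁ n t ω) ⌊ρ * n⌋₊) : ℝ)} ∪
      {ω | ∃ m, j ≤ (hits (fun i => Z₁ n i ω) (Finset.range ⌊x⌋₊) m).card} := by
    intro ω hω
    rw [Set.mem_ofPred_eq] at hω
    by_contra hc
    simp only [Set.mem_union, Set.mem_ofPred_eq, not_or, not_exists, not_le] at hc
    refine hω.not_ge ?_
    have hR : rejections (history (thresholdStrategy n (threshold n)) (fun t => Z₀ n t ω)
      (fun t => Z₁ n t ω) ⌊ρ * n⌋₊) ≤ ⌊x⌋₊ := Nat.le_floor hc.1.le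
    have hmax : randomMaxLoad (Z₀ n) (Z₁ n) ρ (thresholdStrategy n (threshold n)) ω ≤
        ⌈threshold n⌉₊ + j := by
      rw [randomMaxLoad, maxLoad]
      refine Finset.sup_le fun m _ => ?_
      refine (load_thresholdStrategy_le _ _ _ _ m).trans (Nat.add_le_add (min_le_right _ _) ?_)
      refine le_trans (Finset.card_le_card ?_) (hc.2 m).le
      exact Finset.filter_subset_filter _ (Finset.range_mono hR)
    have h4 : (⌈threshold n⌉₊ : ℝ) < threshold n + 1 := Nat.ceil_lt_add_one hL
    have h5 : (j : ℝ) < (1 + ε) * threshold n + 1 := Nat.ceil_lt_add_one (by positivity)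
    have h6 : (randomMaxLoad (Z₀ n) (Z₁ n) ρ (thresholdStrategy n (threshold n)) ω : ℝ) ≤
        ⌈threshold n⌉₊ + j := by exact_mod_cast hmax
    linarith
  refine (measureReal_mono hsub (measure_ne_top _ _)).trans
    ((measureReal_union_le _ _).trans (add_le_add ?_ ?_))
  · refine (measureReal_rejections_thresholdStrategy_le hn hZn _ hρ hx0).trans (le_of_eq ?_)
    rw [hx, Real.exp_neg]
    field_simp
  · refine (hZn.secondary.measureReal_exists_le_card_hits hn _ _).trans ?_
    rw [Finset.card_range]
    have hj1 : (1 + ε) * threshold n ≤ j := Nat.le_ceil _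
    have h4 : (⌊x⌋₊ / n : ℝ) ≤ Real.exp (-((1 - τ) * decayRate n)) := by
      rw [div_le_iff₀ hn0, mul_comm]
      exact Nat.floor_le hx0.le
    calc (n : ℝ) * (⌊x⌋₊ / n : ℝ) ^ j
        ≤ n * Real.exp (-((1 - τ) * decayRate n)) ^ j := by gcongr
      _ = Real.exp (threshold n * decayRate n + j * (-((1 - τ) * decayRate n))) := by
          rw [← Real.exp_nat_mul, Real.exp_add, ← h1]
      _ ≤ _ := by
          refine Real.exp_le_exp.2 ?_
          have : (1 + ε) * threshold n * ((1 - τ) * decayRate n) ≤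
            j * ((1 - τ) * decayRate n) := by gcongr
          linarith

end Bounds

/-! ### Lower bound for an arbitrary strategy. -/

/-- If in each of `S` periods of `q` balls there are more than `2 * x (s + 1)` bins with
`k (s + 1)` primary allocations, and whenever `x s` bins have load `k s` at the beginning of a
period, then some such bin gets `j (s + 1)` of the next `⌈x (s + 1)⌉₊` secondary allocations, then
the maximum load is large. -/
lemma le_maxLoad_of_periods {n : ℕ} (f : Strategy n) (z₀ z₁ : ℕ → Fin n) (S q N : ℕ) (hN : S * q ≤ N)
    (k j : ℕ → ℕ) (x : ℕ → ℝ) (M : ℝ) (hk0 : k 0 = 0) (hx0 : x 0 ≤ n) (hx : ∀ s, 0 < x s)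
    (hkj : ∀ s < S, M ≤ k s + j (s + 1)) (hkS : M ≤ k S)
    (hC : ∀ s < S, 2 * x (s + 1) < ((Finset.univ.filter fun m =>
      k (s + 1) ≤ (hits z₀ (Finset.Ico (s * q) ((s + 1) * q)) m).card).card : ℝ))
    (hD : ∀ s < S, x s ≤ ((Finset.univ.filter fun m =>
      k s ≤ load (history f z₀ z₁ (s * q)) m).card : ℝ) →
      ∃ m, k s ≤ load (history f z₀ z₁ (s * q)) m ∧
        j (s + 1) ≤ (hits z₁ (Finset.Ico (rejections (history f z₀ z₁ (s * q)))
          (rejections (history f z₀ z₁ (s * q)) + ⌈x (s + 1)⌉₊)) m).card) :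
    M ≤ maxLoad f z₀ z₁ N := by
  by_contra! hM
  have main : ∀ s ≤ S, x s ≤ ((Finset.univ.filter fun m =>
      k s ≤ load (history f z₀ z₁ (s * q)) m).card : ℝ) := by
    intro s
    induction s with
    | zero => intro _; simpa [hk0] using hx0
    | succ s ih =>
      intro hs
      obtain ⟨m, hm1, hm2⟩ := hD s hs (ih (by omega))
      have hle : s * q ≤ (s + 1) * q := Nat.mul_le_mul_right _ s.le_succ
      have hle2 : (s + 1) * q ≤ N := (Nat.mul_le_mul_right _ hs).trans hN
      -- With more rejections, all the secondary entries hitting m would be used within the period,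
      -- giving m a load of at least M.
      have hrej : rejections (history f z₀ z₁ ((s + 1) * q)) <
          rejections (history f z₀ z₁ (s * q)) + ⌈x (s + 1)⌉₊ := by
        by_contra! hc
        have h1 := load_add_card_hits_le f z₀ z₁ hle m
        have h2 := load_le_maxLoad f z₀ z₁ hle2 m
        have h3 : (hits z₁ (Finset.Ico (rejections (history f z₀ z₁ (s * q)))
          (rejections (history f z₀ z₁ (s * q)) + ⌈x (s + 1)⌉₊)) m).card ≤
          (hits z₁ (Finset.Ico (rejections (history f z₀ z₁ (s * q)))
          (rejections (history f z₀ z₁ ((s + 1) * q)))) m).card :=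
          Finset.card_le_card (Finset.filter_subset_filter _ (Finset.Ico_subset_Ico_right hc))
        have h4 : k s + j (s + 1) ≤ maxLoad f z₀ z₁ N := by omega
        have h5 : (k s + j (s + 1) : ℝ) ≤ maxLoad f z₀ z₁ N := by exact_mod_cast h4
        linarith [hkj s hs]
      -- Of more than 2 x (s+1) good bins, fewer than x (s+1) are spoiled by rejections, so the
      -- invariant passes to s + 1.
      have h1 := card_bins_le f z₀ z₁ hle (k (s + 1))
      have h2 := hC s hs
      have h3 : rejections (history f z₀ z₁ ((s + 1) * q)) -
          rejections (history f z₀ z₁ (s * q)) < ⌈x (s + 1)⌉₊ := by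
        have := Nat.ceil_pos.2 (hx (s + 1))
        omega
      have h4 := Nat.lt_ceil.1 h3
      have h5 : (((Finset.univ.filter fun m =>
          k (s + 1) ≤ (hits z₀ (Finset.Ico (s * q) ((s + 1) * q)) m).card).card : ℕ) : ℝ) ≤
          (((Finset.univ.filter fun m => k (s + 1) ≤ load (history f z₀ z₁ ((s + 1) * q)) m).card +
          (rejections (history f z₀ z₁ ((s + 1) * q)) -
            rejections (history f z₀ z₁ (s * q))) : ℕ) : ℝ) := by exact_mod_cast h1
      rw [Nat.cast_add] at h5
      linarith
  have hpos : (0 : ℝ) < ((Finset.univ.filter fun m =>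
      k S ≤ load (history f z₀ z₁ (S * q)) m).card : ℝ) := (hx S).trans_le (main S le_rfl)
  obtain ⟨m, hm⟩ := Finset.card_pos.1 (Nat.cast_pos.1 hpos)
  have h1 := (Finset.mem_filter.1 hm).2.trans (load_le_maxLoad f z₀ z₁ hN m)
  have h2 : (k S : ℝ) ≤ maxLoad f z₀ z₁ N := by exact_mod_cast h1
  linarith

/-- Among many bins of load `k`, chosen according to the history, some bin gets `j` of the next
`K` secondary allocations. -/
lemma IsUniformSource.measureReal_no_heavy_bin_le {n : ℕ} (hn : 2 ≤ n) {Ω : Type*}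
    [MeasurableSpace Ω] {P : Measure Ω} {Z₀ Z₁ : ℕ → Ω → Fin n} (hZ : IsUniformSource P Z₀ Z₁)
    (f : Strategy n) (T k j K : ℕ) {x v : ℝ} (hx : 0 < x) (hv : 0 < v) (hjK : j ≤ K)
    (hjn : 4 * j ≤ n)
    (hvB : 2 * v ≤ x * ((K / (j * n) : ℝ) ^ j * Real.exp (-(2 * K / n)))) :
    P.real {ω | x ≤ ((Finset.univ.filter fun m =>
        k ≤ load (history f (fun t => Z₀ t ω) (fun t => Z₁ t ω) T) m).card : ℝ) ∧
      ¬ ∃ m, k ≤ load (history f (fun t => Z₀ t ω) (fun t => Z₁ t ω) T) m ∧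
        j ≤ (hits (fun t => Z₁ t ω) (Finset.Ico
          (rejections (history f (fun t => Z₀ t ω) (fun t => Z₁ t ω) T))
          (rejections (history f (fun t => Z₀ t ω) (fun t => Z₁ t ω) T) + K)) m).card} ≤
      2 / v + 16 * j / n := by
  have := hZ.isProbabilityMeasure
  refine hZ.measureReal_restart_le f T K (fun h y => x ≤ ((Finset.univ.filter fun m =>
        k ≤ load h m).card : ℝ) ∧ ¬ ∃ m, k ≤ load h m ∧
        j ≤ (hits y (Finset.Ico (rejections h) (rejections h + K)) m).card) ?_ ?_
  · rintro h y y' hy ⟨h1, h2⟩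
    refine ⟨h1, ?_⟩
    have : ∀ m, hits y' (Finset.Ico (rejections h) (rejections h + K)) m =
        hits y (Finset.Ico (rejections h) (rejections h + K)) m := fun m =>
      Finset.filter_congr fun i hi => by rw [hy i hi]
    simpa only [this] using h2
  · intro h
    by_cases hB : x ≤ ((Finset.univ.filter fun m => k ≤ load h m).card : ℝ)
    · set B := Finset.univ.filter fun m => k ≤ load h m with hBdef
      have hBne : B.Nonempty := Finset.card_pos.1 (Nat.cast_pos.1 (hx.trans_le hB))
      have hI : (Finset.Ico (rejections h) (rejections h + K)).card = K := by simp
      refine le_trans (measureReal_mono ?_ (measure_ne_top _ _))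
        (hZ.secondary.measureReal_few_bins_le hn B hBne
          (Finset.Ico (rejections h) (rejections h + K)) (j := j) (hI.symm ▸ hjK) hjn hv ?_)
      · rintro ω ⟨-, hω⟩
        simp only [Set.mem_ofPred_eq]
        rw [Finset.filter_eq_empty_iff.2, Finset.card_empty, Nat.cast_zero]
        · exact hv.le
        · intro m hm hjm
          exact hω ⟨m, (Finset.mem_filter.1 hm).2, hjm⟩
      · rw [hI]
        refine hvB.trans ?_
        gcongr
    · have : {ω | x ≤ ((Finset.univ.filter fun m => k ≤ load h m).card : ℝ) ∧
          ¬ ∃ m, k ≤ load h m ∧ j ≤ (hits (fun i => Z₁ i ω)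
            (Finset.Ico (rejections h) (rejections h + K)) m).card} = ∅ :=
        Set.eq_empty_of_forall_notMem fun ω hω => hB hω.1
      rw [this, measureReal_empty]
      positivity

section Bounds

variable {ρ : ℝ} {Ω : ℕ → Type*} [∀ n, MeasurableSpace (Ω n)] {P : ∀ n, Measure (Ω n)}
  {Z₀ Z₁ : ∀ n, ℕ → Ω n → Fin n}

lemma eventually_mul_le_floor_div {ρ : ℝ} (hρ : 0 < ρ) {S : ℕ} (hS : 0 < S) :
    ∀ᶠ n : ℕ in atTop, ρ / (2 * S) * n ≤ (⌊ρ * n⌋₊ / S : ℕ) := by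
  have hS0 : (0 : ℝ) < S := by exact_mod_cast hS
  have h := (tendsto_natCast_atTop_atTop (R := ℝ)).const_mul_atTop
    (show 0 < ρ / (2 * S) by positivity)
  filter_upwards [h.eventually_ge_atTop 2] with n hn
  have h1 : ρ * n < ⌊ρ * n⌋₊ + 1 := Nat.lt_floor_add_one _
  have h2 : ⌊ρ * n⌋₊ < S * (⌊ρ * n⌋₊ / S + 1) := Nat.lt_mul_div_succ _ hS
  have h3 : (⌊ρ * n⌋₊ : ℝ) < S * ((⌊ρ * n⌋₊ / S : ℕ) + 1) := by exact_mod_cast h2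
  have hS1 : (1 : ℝ) ≤ S := by exact_mod_cast hS
  have h4 : ρ * n = 2 * S * (ρ / (2 * S) * n) := by field_simp
  have h5 : S * (2 * (ρ / (2 * S) * n)) < S * ((⌊ρ * n⌋₊ / S : ℕ) + 2) := by linarith
  have h6 := lt_of_mul_lt_mul_left h5 hS0.le
  linarith

theorem tendsto_measureReal_maxLoad_lt (hρ : 0 < ρ)
    (hZ : ∀ n, 1 ≤ n → IsUniformSource (P n) (Z₀ n) (Z₁ n)) (g : ∀ n, Strategy n) {ε : ℝ}
    (hε : 0 < ε) :
    Tendsto (fun n => (P n).real {ω | (randomMaxLoad (Z₀ n) (Z₁ n) ρ (g n) ω : ℝ) <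
      (1 - ε) * (2 * threshold n)}) atTop (𝓝 0) := by
  -- With η = 1/S, the condition S > 4/ε gives 4η ≤ ε, which covers all the multiplicative losses.
  obtain ⟨S, hS⟩ := exists_nat_gt (max 1 (4 / ε))
  have hS1 : (1 : ℝ) < S := (le_max_left _ _).trans_lt hS
  have hS0 : (0 : ℝ) < S := one_pos.trans hS1
  have hSε : 4 / S < ε := by
    rw [div_lt_iff₀ hS0, mul_comm, ← div_lt_iff₀ hε]
    exact (le_max_right _ _).trans_lt hS
  have hSN : 0 < S := by exact_mod_cast hS0
  set η : ℝ := 1 / S with hη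
  have hη0 : 0 < η := by positivity
  have hη1 : η ≤ 1 := by rw [hη, div_le_one hS0]; exact hS1.le
  have hηε : 4 * η ≤ ε := by rw [hη, mul_one_div]; exact hSε.le
  have hη' : 0 ≤ 1 - η := by linarith
  have hηS : η * S = 1 := by rw [hη]; field_simp
  -- The levels run from a 0 = 0 to a S = 2 in steps of 2η.
  set a : ℕ → ℝ := fun s => 2 * η * s with ha
  have ha0 : ∀ s, 0 < a (s + 1) := fun s => by simp only [ha]; positivity
  set q : ℕ → ℕ := fun n => ⌊ρ * n⌋₊ / S with hq
  have hqlow : ∀ᶠ n : ℕ in atTop, ρ / (2 * S) * n ≤ q n := eventually_mul_le_floor_div hρ hSN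
  have hqρ : ∀ n : ℕ, (q n : ℝ) ≤ ρ * n := fun n =>
    le_trans (by exact_mod_cast Nat.div_le_self _ _) (Nat.floor_le (by positivity))
  set k : ℕ → ℕ → ℕ := fun n s => ⌊(1 - η) * a s * threshold n⌋₊ with hk
  set j : ℕ → ℕ → ℕ := fun n s => ⌊(1 - η) / a s * threshold n⌋₊ with hj
  set x : ℕ → ℕ → ℝ := fun n s => n * Real.exp (-(a s * decayRate n)) with hx
  have hκ : 0 < ρ / (2 * S) := by positivity
  have e1 : ∀ᶠ n : ℕ in atTop, ∀ s ∈ Finset.range S, k n (s + 1) ≤ q n ∧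
      4 * k n (s + 1) ≤ n ∧ 2 * (2 * x n (s + 1)) ≤
        n * ((q n / (k n (s + 1) * n) : ℝ) ^ k n (s + 1) * Real.exp (-(2 * q n / n))) :=
    (Finset.eventually_all _).2 fun s _ =>
      eventually_primary_bins hκ (ha0 s) hη0 hη1 hqlow hqρ
  have e2 : ∀ᶠ n : ℕ in atTop, ∀ s ∈ Finset.range S, j n (s + 1) ≤ ⌈x n (s + 1)⌉₊ ∧
      4 * j n (s + 1) ≤ n ∧ 2 * threshold n ≤ x n s *
        ((⌈x n (s + 1)⌉₊ / (j n (s + 1) * n) : ℝ) ^ j n (s + 1) *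
          Real.exp (-(2 * ⌈x n (s + 1)⌉₊ / n))) :=
    (Finset.eventually_all _).2 fun s _ => eventually_secondary_bins (ha0 s) hη0 hη1
  refine squeeze_zero' (g := fun n => ∑ s ∈ Finset.range S, ((2 / (2 * x n (s + 1)) + 16 * k n (s + 1) / n) +
      (2 / threshold n + 16 * j n (s + 1) / n)))
    (Eventually.of_forall fun n => measureReal_nonneg) ?_ ?_
  swap
  · refine Tendsto.mono_right (tendsto_finsetSum (a := fun _ => (0 + 0) + (0 + 0)) _ fun s _ =>
      Tendsto.add (Tendsto.add ?_ ?_) (Tendsto.add ?_ ?_)) (by simp)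
    · exact tendsto_const_nhds.div_atTop ((tendsto_natCast_mul_exp _).const_mul_atTop two_pos)
    · exact tendsto_floor_mul_threshold_div (mul_nonneg hη' (ha0 s).le)
    · exact tendsto_const_nhds.div_atTop tendsto_threshold
    · exact tendsto_floor_mul_threshold_div (div_nonneg hη' (ha0 s).le)
  filter_upwards [eventually_ge_atTop 2, e1, e2, tendsto_threshold.eventually_gt_atTop 0,
    (tendsto_threshold.const_mul_atTop hε).eventually_ge_atTop 2] with n hn h1 h2 hL hLε
  have hZn := hZ n (by omega)
  have := hZn.isProbabilityMeasure
  have hn0 : (0 : ℝ) < n := by positivity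
  have hxpos : ∀ s, 0 < x n s := fun s => by positivity
  set C : ℕ → Set (Ω n) := fun s => {ω | ((Finset.univ.filter fun m => k n (s + 1) ≤
    (hits (fun t => Z₀ n t ω) (Finset.Ico (s * q n) ((s + 1) * q n)) m).card).card : ℝ) ≤
      2 * x n (s + 1)} with hC
  set D : ℕ → Set (Ω n) := fun s => {ω | x n s ≤ ((Finset.univ.filter fun m =>
        k n s ≤ load (history (g n) (fun t => Z₀ n t ω) (fun t => Z₁ n t ω) (s * q n)) m).card : ℝ) ∧
      ¬ ∃ m, k n s ≤ load (history (g n) (fun t => Z₀ n t ω) (fun t => Z₁ n t ω) (s * q n)) m ∧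
        j n (s + 1) ≤ (hits (fun t => Z₁ n t ω) (Finset.Ico
          (rejections (history (g n) (fun t => Z₀ n t ω) (fun t => Z₁ n t ω) (s * q n)))
          (rejections (history (g n) (fun t => Z₀ n t ω) (fun t => Z₁ n t ω) (s * q n)) +
            ⌈x n (s + 1)⌉₊)) m).card} with hD
  have hfloork : ∀ s, (1 - η) * a s * threshold n - 1 ≤ k n s := fun s => by
    have := Nat.lt_floor_add_one ((1 - η) * a s * threshold n)
    simp only [hk]; linarith
  have hfloorj : ∀ s, (1 - η) / a s * threshold n - 1 ≤ j n s := fun s => by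
    have := Nat.lt_floor_add_one ((1 - η) / a s * threshold n)
    simp only [hj]; linarith
  have hkj : ∀ s < S, (1 - ε) * (2 * threshold n) ≤ k n s + j n (s + 1) := by
    intro s _
    have h3 := hfloork s
    have h4 := hfloorj (s + 1)
    -- The inequality y + 1/y ≥ 2 at y = a (s+1), less the step 2η between consecutive levels.
    have h5 : 2 - 2 * η ≤ a s + 1 / a (s + 1) := by
      have h6 := ha0 s
      have h7 : a s = a (s + 1) - 2 * η := by simp only [ha]; push_cast; ring
      have h8 : 2 ≤ a (s + 1) + 1 / a (s + 1) := by
        rw [← sub_nonneg, show a (s + 1) + 1 / a (s + 1) - 2 = (a (s + 1) - 1) ^ 2 / a (s + 1) by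
          field_simp; ring]
        positivity
      linarith
    have h9 : (1 - η) * (2 - 2 * η) * threshold n ≤
        (1 - η) * (a s + 1 / a (s + 1)) * threshold n := by gcongr
    have h10 : (1 - η) * (a s + 1 / a (s + 1)) * threshold n =
        (1 - η) * a s * threshold n + (1 - η) / a (s + 1) * threshold n := by ring
    -- (1-η)(2-2η) ≥ 2 - 4η ≥ 2 - ε, and the two floors lose at most 2 ≤ ε L.
    nlinarith [mul_pos hη0 hL, mul_nonneg (mul_nonneg hη0.le hη0.le) hL.le]
  have hkS : (1 - ε) * (2 * threshold n) ≤ k n S := by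
    have h3 := hfloork S
    have h4 : a S = 2 := by simp only [ha]; linarith
    rw [h4] at h3
    nlinarith [mul_pos hη0 hL]
  have hsub : {ω | (randomMaxLoad (Z₀ n) (Z₁ n) ρ (g n) ω : ℝ) <
      (1 - ε) * (2 * threshold n)} ⊆
      ⋃ s ∈ Finset.range S, (C s ∪ D s) := by
    intro ω hω
    rw [Set.mem_ofPred_eq] at hω
    by_contra hc
    simp only [Set.mem_iUnion, Finset.mem_range, not_exists, Set.mem_union, not_or] at hc
    refine hω.not_ge (le_maxLoad_of_periods (g n) (fun t => Z₀ n t ω) (fun t => Z₁ n t ω) S (q n) _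
      (Nat.mul_div_le _ _) (k n) (j n) (x n) _ ?_ ?_ hxpos hkj hkS ?_ ?_)
    · simp [hk, ha]
    · simp [hx, ha]
    · intro s hs
      have := (hc s hs).1
      simpa only [hC, Set.mem_ofPred_eq, not_le] using this
    · intro s hs hxs
      by_contra hne
      exact (hc s hs).2 ⟨hxs, hne⟩
  refine (measureReal_mono hsub (measure_ne_top _ _)).trans
    ((measureReal_biUnion_finset_le _ _).trans (Finset.sum_le_sum fun s hs => ?_))
  refine (measureReal_union_le _ _).trans (add_le_add ?_ ?_)
  · obtain ⟨h3, h4, h5⟩ := h1 s hs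
    have hI : (Finset.Ico (s * q n) ((s + 1) * q n)).card = q n := by
      rw [Nat.card_Ico, add_mul, one_mul, Nat.add_sub_cancel_left]
    have hne : (Finset.univ : Finset (Fin n)).Nonempty := ⟨⟨0, by omega⟩, Finset.mem_univ _⟩
    refine hZn.primary.measureReal_few_bins_le hn Finset.univ hne _ (by rw [hI]; exact h3) h4
      (by have := hxpos (s + 1); positivity) ?_
    rw [hI, Finset.card_univ, Fintype.card_fin]
    exact h5
  · obtain ⟨h3, h4, h5⟩ := h2 s hs
    exact hZn.measureReal_no_heavy_bin_le hn (g n) (s * q n) (k n s) (j n (s + 1)) _ (hxpos s) hL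
      h3 h4 h5

end Bounds

end TwoThinning

/-! ### Conclusion from the two bounds. -/

theorem theorem1 (ρ : ℝ) (hρ : 0 < ρ)
    (Ω : ℕ → Type*) [∀ n, MeasurableSpace (Ω n)] (P : ∀ n, Measure (Ω n))
    (Z₀ Z₁ : ∀ n, ℕ → Ω n → Fin n)
    (hZ : ∀ n, 1 ≤ n → TwoThinning.IsUniformSource (P n) (Z₀ n) (Z₁ n))
    (f : ∀ n, TwoThinning.Strategy n)
    (hf : ∀ n, f n =
      TwoThinning.thresholdStrategy n √(2 * Real.log n / Real.log (Real.log n))) :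
    TwoThinning.AsymptoticallyOptimal P Z₀ Z₁ ρ f ∧
      ∀ ε : ℝ, 0 < ε →
        TwoThinning.WithHighProbability P fun n =>
          {ω | (1 - ε) * √(8 * Real.log n / Real.log (Real.log n)) ≤
              (TwoThinning.randomMaxLoad (Z₀ n) (Z₁ n) ρ (f n) ω : ℝ) ∧
            (TwoThinning.randomMaxLoad (Z₀ n) (Z₁ n) ρ (f n) ω : ℝ) ≤
              (1 + ε) * √(8 * Real.log n / Real.log (Real.log n))} := by
  obtain rfl : f = fun n => TwoThinning.thresholdStrategy n (TwoThinning.threshold n) := funext hf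
  have hP := TwoThinning.eventually_isProbabilityMeasure hZ
  constructor
  · intro g ε hε
    -- The solution of 1 + δ = (1+ε)(1-δ), so the upper bound for f and the lower bound for g
    -- combine exactly.
    set δ : ℝ := ε / (2 + ε) with hδ
    have hδ0 : 0 < δ := by positivity
    have hδε : (1 + δ) ≤ (1 + ε) * (1 - δ) := by
      refine le_of_eq ?_
      rw [hδ]; field_simp; ring
    have h := (TwoThinning.tendsto_measureReal_maxLoad_thresholdStrategy_gt hρ hZ hδ0).add
      (TwoThinning.tendsto_measureReal_maxLoad_lt hρ hZ g hδ0)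
    rw [add_zero] at h
    refine TwoThinning.WithHighProbability.of_compl_le hP h ?_
    filter_upwards [hP] with n hn
    refine (measureReal_mono (fun ω hω => ?_) (measure_ne_top _ _)).trans
      (measureReal_union_le _ _)
    by_contra hc
    simp only [Set.mem_union, Set.mem_ofPred_eq, not_or, not_lt] at hc
    refine hω ?_
    have hL := TwoThinning.threshold_nonneg n
    calc _ ≤ (1 + δ) * (2 * TwoThinning.threshold n) := hc.1
      _ ≤ (1 + ε) * (1 - δ) * (2 * TwoThinning.threshold n) := by gcongr
      _ = (1 + ε) * ((1 - δ) * (2 * TwoThinning.threshold n)) := by ring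
      _ ≤ _ := mul_le_mul_of_nonneg_left hc.2 (by positivity)
  · intro ε hε
    -- The lower bound holds for every strategy, in particular for the threshold strategy itself.
    have h := (TwoThinning.tendsto_measureReal_maxLoad_thresholdStrategy_gt hρ hZ hε).add
      (TwoThinning.tendsto_measureReal_maxLoad_lt hρ hZ
        (fun n => TwoThinning.thresholdStrategy n (TwoThinning.threshold n)) hε)
    rw [add_zero] at h
    refine TwoThinning.WithHighProbability.of_compl_le hP h ?_
    filter_upwards [hP] with n hn
    refine (measureReal_mono (fun ω hω => ?_) (measure_ne_top _ _)).trans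
      (measureReal_union_le _ _)
    by_contra hc
    simp only [Set.mem_union, Set.mem_ofPred_eq, not_or, not_lt] at hc
    refine hω ?_
    simp only [TwoThinning.sqrt_eight_mul_log_div]
    exact ⟨hc.2, hc.1⟩
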